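/- **Setting.** Let $\mathbb T=\mathbb R/\mathbb Z$ and let $\mathbb M/\mathbb Z$ be the flat cylinder: $\mathbb R^2$ with light-cone coordinates $(x^+,x^-)$ modulo $(x^+,x^-)\sim(x^++1,x^--1)$. On compactly supported $1$-forms $\Omega^1_c=\Omega^1_c(\mathbb M/\mathbb Z)$ the Hodge operator is $\ast\,\mathrm dx^\pm=\pm\,\mathrm dx^\pm$; put $\Omega^{1,\pm}_c=\{\alpha\in\Omega^1_c:\ast\alpha=\pm\alpha\}=C_c^\infty(\mathbb M/\mathbb Z)\,\mathrm dx^\pm$ and $\mathrm d^\pm=\tfrac12(\mathrm{id}\pm\ast)\mathrm d$. The space of linear observables of the Abelian current is $$\mathfrak L=\frac{\Omega^1_c}{\mathrm dC_c^\infty+\ast\,\mathrm dC_c^\infty}=\frac{\Omega^{1,-}_c}{\mathrm d^-C^\infty_c}\oplus\frac{\Omega^{1,+}_c}{\mathrm d^+C^\infty_c},$$ with Poisson structure $\tau([\alpha],[\beta])=\int_{\mathbb M/\mathbb Z}\mathrm d\alpha\;G(\mathrm d\beta)$, where $\mathbb M/\mathbb Z$ is oriented by $\mathrm dx^-\wedge\mathrm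 dx^+$ and $G$ is the (retarded minus advanced) causal propagator of $\mathrm d\ast\mathrm d:C^\infty\to\Omega^2$. For a real vector space $V$ with an antisymmetric bilinear form $\tau$, $\mathfrak{CCR}(V,\tau)$ denotes the complex $*$-algebra $\mathrm{Sym}_{\mathbb C}V=\mathbb C\otimes_{\mathbb R}\mathrm{Sym}_{\mathbb R}V$ with the Moyal–Weyl product of $\tfrac{\mathrm i}{2}\tau$ (so that $[v,w]_\star=\mathrm i\,\tau(v,w)$ for $v,w\in V$) and complex conjugation as involution. Put $\mathfrak A(\mathbb M/\mathbb Z)=\mathfrak{CCR}(\mathfrak L,\tau)$. The endomorphisms of $\mathbb M/\mathbb Z$ (orientation and time-orientation preserving, causally convex conformal embeddings) are the maps $g:[(x^+,x^-)]\mapsto[(g^+(x^+),g^-(x^-))]$, where $g^\pm:\mathbb R\to\mathbb R$ are lifts of orientation preserving diffeomorphisms of $\mathbb T$. They act on $\mathfrak L$ by push-forward $[\alpha]\mapsto[(g^{-1})^*\alpha]$ and hence on $\mathfrak A(\mathbb M/\mathbb Z)$ by $*$-automorphisms $\mathfrak A(g)$. Let $\pi_\pm(g)\in\mathrm{Diff}^+(\mathbb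 T)$ be the diffeomorphism with lift $g^\pm$. The chiral component ${\pi_\pm}_*(\mathfrak A)(\mathbb T)$ is the value at $\mathbb T$ of the right Kan extension of $\mathfrak A$ along $\pi_\pm$, i.e. the limit of $\mathfrak A$ over the comma category $\mathbb T\downarrow\pi_\pm$: the $*$-algebra of all families $(a_h)_{h\in\mathrm{Diff}^+(\mathbb T)}$ in $\mathfrak A(\mathbb M/\mathbb Z)$ with $\mathfrak A(g)(a_h)=a_{\pi_\pm(g)h}$ for all $g$ and $h$. Let $H^1_c$ be the first compactly supported de Rham cohomology of $\mathbb M/\mathbb Z$, and let $H^{1,\pm}_c\subseteq\mathfrak L$ be the projection to the summand $\Omega^{1,\pm}_c/\mathrm d^\pm C^\infty_c$ of the image of $H^1_c\oplus H^1_c\to\mathfrak L$, $[\alpha]\oplus[\beta]\mapsto[\alpha+\ast\beta]$. **Proposition.** For each choice of the sign $\pm$, the following hold. 1. The map ${\pi_\pm}_*(\mathfrak A)(\mathbb T)\to\mathfrak A(\mathbb M/\mathbb Z)$, $(a_h)_h\mapsto a_{\mathrm{id}}$, is injective. Its image consists of the elements that are fixed by $\mathfrak A(g)$ for all $g$ with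 $\pi_\pm(g)=\mathrm{id}$. 2. $\dim_{\mathbb R}H^{1,\pm}_c=1$, and the sum $$\mathfrak L^\pm:=\frac{\Omega^{1,\mp}_c}{\mathrm d^\mp C^\infty_c}\oplus H^{1,\pm}_c\subseteq\mathfrak L$$ is direct. The $*$-homomorphism $\mathfrak{CCR}(\mathfrak L^\pm,\tau)\to\mathfrak{CCR}(\mathfrak L,\tau)=\mathfrak A(\mathbb M/\mathbb Z)$ induced by the inclusion is injective and has the same image as the map in 1. Thus, as $*$-subalgebras of $\mathfrak A(\mathbb M/\mathbb Z)$, $${\pi_\pm}_*(\mathfrak A)(\mathbb T)=\mathfrak{CCR}(\mathfrak L^\pm,\tau)\subseteq\mathfrak A(\mathbb M/\mathbb Z).$$ 3. There is an isomorphism of complex $*$-algebras $${\pi_\pm}_*(\mathfrak A)(\mathbb T)\;\cong\;\mathfrak{CCR}\big(C^\infty(\mathbb T),\tau_{\mathbb T}\big)\otimes_{\mathbb C}\mathrm{Sym}_{\mathbb C}\,\mathbb R,\qquad \tau_{\mathbb T}(\varphi,\psi)=-\tfrac12\int_{\mathbb T}\varphi\,\mathrm d\psi .$$ -/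

import Mathlib

open scoped TensorProduct ContDiff

noncomputable section

/-- The complexified symmetric algebra `ℂ ⊗ Sym V` of a real vector space `V`. -/
def SymC (V : Type*) [AddCommGroup V] [Module ℝ V] : Type _ := ℂ ⊗[ℝ] SymmetricAlgebra ℝ V

namespace SymC

variable {V W : Type*} [AddCommGroup V] [Module ℝ V] [AddCommGroup W] [Module ℝ W]

instance : CommRing (SymC V) := inferInstanceAs (CommRing (ℂ ⊗[ℝ] SymmetricAlgebra ℝ V))
instance : Algebra ℂ (SymC V) := inferInstanceAs (Algebra ℂ (ℂ ⊗[ℝ] SymmetricAlgebra ℝ V))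

/-- The inclusion of the real symmetric algebra. -/
def ofReal (x : SymmetricAlgebra ℝ V) : SymC V := (1 : ℂ) ⊗ₜ[ℝ] x

/-- The canonical inclusion of `V` into its complexified symmetric algebra. -/
def ι : V →ₗ[ℝ] SymC V where
  toFun v := ofReal (SymmetricAlgebra.ι ℝ V v)
  map_add' v w := by rw [map_add]; exact TensorProduct.tmul_add _ _ _
  map_smul' c v := by
    rw [map_smul, ofReal, TensorProduct.tmul_smul]
    rfl

theorem smul_ofReal (c : ℂ) (x : SymmetricAlgebra ℝ V) :
    c • ofReal x = (show ℂ ⊗[ℝ] SymmetricAlgebra ℝ V from c ⊗ₜ[ℝ] x) := by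
  have : c • ((1 : ℂ) ⊗ₜ[ℝ] x : ℂ ⊗[ℝ] SymmetricAlgebra ℝ V) = c ⊗ₜ[ℝ] x := by
    rw [TensorProduct.smul_tmul', smul_eq_mul, mul_one]
  exact this

theorem induction {P : SymC V → Prop} (one : P 1)
    (smul : ∀ (c : ℂ) a, P a → P (c • a)) (add : ∀ a b, P a → P b → P (a + b))
    (ι_mul : ∀ v a, P a → P (ι v * a)) (a : SymC V) : P a := by
  have key : ∀ (x : SymmetricAlgebra ℝ V) (a : SymC V), P a → P (ofReal x * a) := by
    intro x
    induction x using SymmetricAlgebra.induction with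
    | algebraMap r =>
      intro a ha
      have : ofReal (algebraMap ℝ (SymmetricAlgebra ℝ V) r) * a = (r : ℂ) • a := by
        rw [Algebra.smul_def]
        congr 1
        change (1 : ℂ) ⊗ₜ[ℝ] (algebraMap ℝ (SymmetricAlgebra ℝ V) r) = (r : ℂ) ⊗ₜ[ℝ] 1
        rw [Algebra.algebraMap_eq_smul_one, TensorProduct.tmul_smul, TensorProduct.smul_tmul']
        simp
      rw [this]
      exact smul _ _ ha
    | ι v => intro a ha; exact ι_mul v a ha
    | mul x y hx hy =>
      intro a ha
      have := hx _ (hy a ha)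
      rw [← mul_assoc] at this
      convert this using 2
      change _ = ((1 : ℂ) ⊗ₜ[ℝ] x : ℂ ⊗[ℝ] SymmetricAlgebra ℝ V) * ((1 : ℂ) ⊗ₜ[ℝ] y)
      rw [Algebra.TensorProduct.tmul_mul_tmul, one_mul, ofReal]
    | add x y hx hy =>
      intro a ha
      have := add _ _ (hx a ha) (hy a ha)
      rw [← add_mul] at this
      convert this using 2
      exact TensorProduct.tmul_add _ _ _
  induction a using TensorProduct.induction_on with
  | zero => have := smul 0 1 one; rwa [zero_smul] at this
  | tmul c x =>
    have := smul c _ (key x 1 one)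
    rw [mul_one, smul_ofReal] at this
    exact this
  | add x y hx hy => exact add _ _ hx hy

section lift
variable {E : Type*} [Ring E] [Algebra ℂ E]

/-- Commuting elements `X v` of a complex algebra, depending real-linearly on `v`, extend to a
homomorphism on the complexified symmetric algebra. -/
def lift (X : V → E) (hadd : ∀ v w, X (v + w) = X v + X w)
    (hsmul : ∀ (r : ℝ) v, X (r • v) = (r : ℂ) • X v) (hcomm : ∀ v w, X v * X w = X w * X v) :
    SymC V →ₐ[ℂ] E :=
  let Y : V →ₗ[ℝ] E := { toFun := X, map_add' := hadd, map_smul' := hsmul }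
  Algebra.TensorProduct.lift (Algebra.ofId ℂ E)
    (RingCon.liftₐ (TensorAlgebra.symRingCon ℝ V) (TensorAlgebra.lift ℝ Y)
      (by
        have : TensorAlgebra.symRingCon ℝ V ≤ RingCon.ker (TensorAlgebra.lift ℝ Y).toRingHom := by
          refine RingCon.ringConGen_le.2 (fun x y h' => ?_)
          induction h' with | mul_comm x y
          rw [RingCon.ker_apply]
          simp [Y, hcomm]
        exact this))
    (fun c _ => Algebra.commutes c _)

theorem lift_ι (X : V → E) (hadd : ∀ v w, X (v + w) = X v + X w)
    (hsmul : ∀ (r : ℝ) v, X (r • v) = (r : ℂ) • X v) (hcomm : ∀ v w, X v * X w = X w * X v)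
    (v : V) : lift X hadd hsmul hcomm (ι v) = X v := by
  let Y : V →ₗ[ℝ] E := { toFun := X, map_add' := hadd, map_smul' := hsmul }
  have : lift X hadd hsmul hcomm (ι v)
      = (1 : E) * TensorAlgebra.lift ℝ Y (TensorAlgebra.ι ℝ v) := by
    rw [← map_one (Algebra.ofId ℂ E)]
    rfl
  rw [this, one_mul, TensorAlgebra.lift_ι_apply]
  rfl

end lift

theorem ι_smul (r : ℝ) (v : V) : ι (r • v) = (r : ℂ) • ι v := map_smul ι r v

/-- The functorial action of linear maps on complexified symmetric algebras. -/
def map (f : V →ₗ[ℝ] W) : SymC V →ₐ[ℂ] SymC W := lift (fun v => ι (f v)) (by simp)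
  (fun r v => by rw [map_smul, ι_smul]) (fun _ _ => mul_comm _ _)

@[simp] theorem map_ι (f : V →ₗ[ℝ] W) (v : V) : map f (ι v) = ι (f v) := lift_ι _ _ _ _ v

/-- Complex conjugation of coefficients. -/
def conj : SymC V →+* SymC V :=
  (Algebra.TensorProduct.map (Complex.conjAe : ℂ →ₐ[ℝ] ℂ)
    (AlgHom.id ℝ (SymmetricAlgebra ℝ V))).toRingHom

@[simp] theorem conj_ι (v : V) : conj (ι v) = ι v := by
  have : conj (ι v) = (show ℂ ⊗[ℝ] SymmetricAlgebra ℝ V from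
      ((starRingEnd ℂ) 1 : ℂ) ⊗ₜ[ℝ] SymmetricAlgebra.ι ℝ V v) := rfl
  rw [this, map_one]
  rfl

@[simp] theorem conj_smul (c : ℂ) (a : SymC V) : conj (c • a) = (starRingEnd ℂ) c • conj a := by
  rw [Algebra.smul_def, map_mul, Algebra.smul_def]
  congr 1

@[simp] theorem conj_conj (a : SymC V) : conj (conj a) = a := by
  induction a using SymC.induction with
  | one => simp
  | smul c a h => simp [h]
  | add a b ha hb => simp [ha, hb]
  | ι_mul v a h => simp [h]

instance : StarRing (SymC V) where
  star := conj
  star_involutive := conj_conj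
  star_mul a b := by rw [map_mul, mul_comm]
  star_add := map_add _

theorem star_def (a : SymC V) : star a = conj a := rfl

instance : StarModule ℂ (SymC V) where
  star_smul c a := by simp [star_def]

/-- The homomorphism `v ↦ v + ε ℓ v` to the dual numbers over the complexified symmetric
algebra. -/
def shift (ℓ : V →ₗ[ℝ] ℝ) : SymC V →ₐ[ℂ] TrivSqZeroExt (SymC V) (SymC V) :=
  lift (fun v => TrivSqZeroExt.inl (ι v) + TrivSqZeroExt.inr (((ℓ v : ℝ) : ℂ) • 1))
    (fun v w => by
      refine TrivSqZeroExt.ext ?_ ?_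
      · simp
      · simp only [map_add, Complex.ofReal_add, add_smul, TrivSqZeroExt.snd_add,
          TrivSqZeroExt.snd_inl, TrivSqZeroExt.snd_inr, zero_add])
    (fun r v => by
      refine TrivSqZeroExt.ext ?_ ?_
      · simp only [ι_smul, TrivSqZeroExt.fst_add, TrivSqZeroExt.fst_inl, TrivSqZeroExt.fst_inr,
          TrivSqZeroExt.fst_smul, add_zero]
      · simp only [map_smul, smul_eq_mul, Complex.ofReal_mul, mul_smul, TrivSqZeroExt.snd_add,
          TrivSqZeroExt.snd_inl, TrivSqZeroExt.snd_inr, TrivSqZeroExt.snd_smul, zero_add])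
    (fun _ _ => mul_comm _ _)

/-- The derivation of the complexified symmetric algebra with `v ↦ ℓ v` on generators
(contraction with the linear form `ℓ`): the infinitesimal part of `v ↦ v + ε ℓ v`. -/
def contract (ℓ : V →ₗ[ℝ] ℝ) : SymC V →ₗ[ℂ] SymC V :=
  (TrivSqZeroExt.sndHom (SymC V) (SymC V)).restrictScalars ℂ ∘ₗ (shift ℓ).toLinearMap

section
variable (ℓ : V →ₗ[ℝ] ℝ)

@[simp] theorem contract_one : contract ℓ (1 : SymC V) = 0 := by simp [contract]

@[simp] theorem contract_ι_mul (v : V) (a : SymC V) :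
    contract ℓ (ι v * a) = ((ℓ v : ℝ) : ℂ) • a + ι v * contract ℓ a := by
  have hfst : ∀ a : SymC V, (shift ℓ a).fst = a := by
    intro a
    induction a using SymC.induction with
    | one => simp
    | smul c a h => simp [h]
    | add a b ha hb => simp [ha, hb]
    | ι_mul v a h => simp only [map_mul, TrivSqZeroExt.fst_mul, h]; simp [shift, lift_ι]
  have hι : shift ℓ (ι v) = TrivSqZeroExt.inl (ι v) + TrivSqZeroExt.inr (((ℓ v : ℝ) : ℂ) • 1) :=
    lift_ι _ _ _ _ v
  have : ∀ a, contract ℓ a = (shift ℓ a).snd := fun _ => rfl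
  rw [this, this, map_mul, TrivSqZeroExt.snd_mul, hfst, hfst, hι]
  simp [-Complex.coe_smul, add_comm]

theorem contract_comm (ℓ' : V →ₗ[ℝ] ℝ) (a : SymC V) :
    contract ℓ (contract ℓ' a) = contract ℓ' (contract ℓ a) := by
  induction a using SymC.induction with
  | one => simp
  | smul c a h => simp [h]
  | add a b ha hb => simp [ha, hb]
  | ι_mul v a h => simp [h]; abel

theorem conj_contract (a : SymC V) : conj (contract ℓ a) = contract ℓ (conj a) := by
  induction a using SymC.induction with
  | one => simp
  | smul c a h => simp [h]
  | add a b ha hb => simp [ha, hb]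
  | ι_mul v a h => simp [h, -Complex.coe_smul]

end

end SymC

/-- A Poisson vector space structure: an antisymmetric bilinear form. -/
structure PoissonForm (V : Type*) [AddCommGroup V] [Module ℝ V] where
  /-- the underlying bilinear form -/
  form : V →ₗ[ℝ] V →ₗ[ℝ] ℝ
  alt : ∀ v, form v v = 0

namespace PoissonForm
variable {V : Type*} [AddCommGroup V] [Module ℝ V]

theorem neg (τ : PoissonForm V) (v w : V) : τ.form w v = - τ.form v w := by
  have h := τ.alt (v + w)
  simp only [map_add, LinearMap.add_apply, τ.alt] at h
  linarith

/-- Restriction of a Poisson structure to a linear subspace. -/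
def restrict (τ : PoissonForm V) (U : Submodule ℝ V) : PoissonForm U where
  form := τ.form.domRestrict₁₂ U U
  alt v := τ.alt v

end PoissonForm

namespace SymC
variable {V W : Type*} [AddCommGroup V] [Module ℝ V] [AddCommGroup W] [Module ℝ W]

theorem contract_add (ℓ ℓ' : V →ₗ[ℝ] ℝ) (a : SymC V) :
    contract (ℓ + ℓ') a = contract ℓ a + contract ℓ' a := by
  induction a using SymC.induction with
  | one => simp
  | smul c a h => simp only [map_smul, h, smul_add]
  | add a b ha hb => simp only [map_add, ha, hb]; abel
  | ι_mul v a h =>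
    simp only [contract_ι_mul, h, LinearMap.add_apply, Complex.ofReal_add, add_smul, mul_add]; abel

theorem contract_smul (r : ℝ) (ℓ : V →ₗ[ℝ] ℝ) (a : SymC V) :
    contract (r • ℓ) a = (r : ℂ) • contract ℓ a := by
  induction a using SymC.induction with
  | one => simp
  | smul c a h => simp only [map_smul, h, smul_comm c]
  | add a b ha hb => simp only [map_add, ha, hb, smul_add]
  | ι_mul v a h =>
    simp only [contract_ι_mul, h, LinearMap.smul_apply, smul_eq_mul, Complex.ofReal_mul, mul_smul,
      smul_add, mul_smul_comm]

/-- The operator `v ⊗ 1 + (i/2) 1 ⊗ {v, ·}` on `Sym ⊗ Sym`, where `{v, ·}` is the derivation given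
by contraction with `τ(v, ·)`. It is the conjugate of multiplication by `v ⊗ 1` with the
exponential of the bidifferential operator `(i/2) τ`. -/
def twist (τ : PoissonForm V) (v : V) : Module.End ℂ (SymC V ⊗[ℂ] SymC V) :=
  LinearMap.rTensor (SymC V) (LinearMap.mulLeft ℂ (ι v))
    + (Complex.I / 2) • LinearMap.lTensor (SymC V) (contract (τ.form v))

theorem twist_tmul (τ : PoissonForm V) (v : V) (a b : SymC V) :
    twist τ v (a ⊗ₜ b) = (ι v * a) ⊗ₜ b + (Complex.I / 2) • (a ⊗ₜ contract (τ.form v) b) := by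
  simp [twist]

theorem twist_comm (τ : PoissonForm V) (v w : V) :
    twist τ v * twist τ w = twist τ w * twist τ v := by
  refine TensorProduct.ext' fun a b => ?_
  simp only [Module.End.mul_apply, twist_tmul, map_add, map_smul,
    contract_comm (τ.form w) (τ.form v), mul_left_comm (ι w) (ι v)]
  module

/-- The homomorphism from the symmetric algebra to operators on `Sym ⊗ Sym` with
`v ↦ twist τ v`. -/
def twistHom (τ : PoissonForm V) : SymC V →ₐ[ℂ] Module.End ℂ (SymC V ⊗[ℂ] SymC V) :=
  lift (twist τ)
    (fun v w => by
      refine TensorProduct.ext' fun a b => ?_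
      simp only [LinearMap.add_apply, twist_tmul, map_add, contract_add, add_mul,
        TensorProduct.add_tmul, TensorProduct.tmul_add, smul_add]
      abel)
    (fun r v => by
      refine TensorProduct.ext' fun a b => ?_
      simp only [LinearMap.smul_apply, twist_tmul, map_smul τ.form, contract_smul, ι_smul,
        smul_mul_assoc, TensorProduct.tmul_smul, ← TensorProduct.smul_tmul', smul_add,
        smul_comm (r : ℂ)])
    (twist_comm τ)

theorem twistHom_ι (τ : PoissonForm V) (v : V) : twistHom τ (ι v) = twist τ v :=
  lift_ι _ _ _ _ v

/-- The Moyal-Weyl star product `a ⋆ b = μ (exp ((i/2) τ) (a ⊗ b))` on the complexified symmetric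
algebra, where `τ` acts as the bidifferential operator `v ⊗ w ↦ τ(v, w)`. As
`exp ((i/2) τ)` fixes `1 ⊗ b`, one computes `exp ((i/2) τ) (a ⊗ b)` by letting the
operators `twist τ v` act on `1 ⊗ b` in place of the factors `v` of `a`. -/
def moyal (τ : PoissonForm V) (a b : SymC V) : SymC V :=
  LinearMap.mul' ℂ (SymC V) (twistHom τ a (1 ⊗ₜ b))

section moyal
variable (τ : PoissonForm V)

theorem moyal_one (b : SymC V) : moyal τ 1 b = b := by simp [moyal]

theorem moyal_add_left (a a' b : SymC V) : moyal τ (a + a') b = moyal τ a b + moyal τ a' b := by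
  simp [moyal]

theorem moyal_smul_left (c : ℂ) (a b : SymC V) : moyal τ (c • a) b = c • moyal τ a b := by
  simp [moyal]

theorem moyal_add_right (a b b' : SymC V) : moyal τ a (b + b') = moyal τ a b + moyal τ a b' := by
  simp [moyal, TensorProduct.tmul_add]

theorem moyal_smul_right (c : ℂ) (a b : SymC V) : moyal τ a (c • b) = c • moyal τ a b := by
  simp [moyal]

/-- The recursion `(v a) ⋆ b = v (a ⋆ b) + (i/2) a ⋆ {v, b}` that determines the star product. -/
theorem moyal_ι_mul (v : V) (a b : SymC V) :
    moyal τ (ι v * a) b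
      = ι v * moyal τ a b + (Complex.I / 2) • moyal τ a (contract (τ.form v) b) := by
  have h1 : ∀ t, LinearMap.mul' ℂ (SymC V) (twist τ v t) = ι v * LinearMap.mul' ℂ (SymC V) t
      + (Complex.I / 2) • LinearMap.mul' ℂ (SymC V)
        (LinearMap.lTensor (SymC V) (contract (τ.form v)) t) := by
    intro t
    induction t using TensorProduct.induction_on with
    | zero => simp
    | tmul a b => simp [twist_tmul, mul_assoc]
    | add x y hx hy => simp only [map_add, hx, hy, mul_add, smul_add]; abel
  have h2 : ∀ a t, LinearMap.lTensor (SymC V) (contract (τ.form v))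
      (twistHom τ a t) = twistHom τ a
        (LinearMap.lTensor (SymC V) (contract (τ.form v)) t) := by
    intro a
    induction a using SymC.induction with
    | one => simp
    | smul c a h => intro t; simp [h]
    | add a b ha hb => intro t; simp [ha, hb]
    | ι_mul w a h =>
      have h3 : ∀ t, LinearMap.lTensor (SymC V) (contract (τ.form v)) (twist τ w t)
          = twist τ w (LinearMap.lTensor (SymC V) (contract (τ.form v)) t) := by
        intro t
        induction t using TensorProduct.induction_on with
        | zero => simp
        | tmul a b => simp [twist_tmul, contract_comm (τ.form v) (τ.form w)]
        | add x y hx hy => simp only [map_add, hx, hy]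
      intro t
      rw [map_mul, twistHom_ι, Module.End.mul_apply, Module.End.mul_apply, h3, h]
  rw [moyal, map_mul, twistHom_ι, Module.End.mul_apply, h1, h2]
  simp [moyal]

theorem moyal_zero_right (a : SymC V) : moyal τ a 0 = 0 := by simp [moyal]

theorem moyal_one_right (a : SymC V) : moyal τ a 1 = a := by
  induction a using SymC.induction with
  | one => exact moyal_one τ 1
  | smul c a h => rw [moyal_smul_left, h]
  | add a b ha hb => rw [moyal_add_left, ha, hb]
  | ι_mul v a h => rw [moyal_ι_mul, h, contract_one, moyal_zero_right, smul_zero, add_zero]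

theorem contract_moyal (ℓ : V →ₗ[ℝ] ℝ) (a b : SymC V) :
    contract ℓ (moyal τ a b) = moyal τ (contract ℓ a) b + moyal τ a (contract ℓ b) := by
  induction a using SymC.induction generalizing b with
  | one => simp [moyal]
  | smul c a h => simp only [moyal_smul_left, map_smul, h, smul_add]
  | add a a' ha hb => simp only [moyal_add_left, map_add, ha, hb]; abel
  | ι_mul v a h =>
    simp only [moyal_ι_mul, map_add, contract_ι_mul, map_smul, h, moyal_add_left, moyal_smul_left,
      contract_comm ℓ (τ.form v), mul_add, smul_add]
    abel

theorem moyal_assoc (a b c : SymC V) : moyal τ (moyal τ a b) c = moyal τ a (moyal τ b c) := by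
  induction a using SymC.induction generalizing b c with
  | one => simp only [moyal_one]
  | smul z a h => simp only [moyal_smul_left, h]
  | add a a' ha hb => simp only [moyal_add_left, ha, hb]
  | ι_mul v a h =>
    simp only [moyal_ι_mul, moyal_add_left, moyal_smul_left, h, contract_moyal, moyal_add_right,
      smul_add, add_assoc]
    abel

theorem moyal_mul_ι (v : V) (a b : SymC V) :
    moyal τ a (ι v * b)
      = ι v * moyal τ a b - (Complex.I / 2) • moyal τ (contract (τ.form v) a) b := by
  induction a using SymC.induction generalizing b with
  | one => simp [moyal]
  | smul c a h =>
    simp only [moyal_smul_left, h, map_smul, smul_sub, mul_smul_comm]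
    rw [smul_comm c]
  | add a a' ha hb => simp only [moyal_add_left, map_add, ha, hb, mul_add, smul_add]; abel
  | ι_mul w a h =>
    rw [moyal_ι_mul, contract_ι_mul, h, moyal_add_right, h, moyal_smul_right, moyal_ι_mul,
      contract_ι_mul, moyal_add_left, moyal_smul_left, moyal_ι_mul, τ.neg v w]
    simp only [mul_add, mul_sub, smul_add, smul_sub, mul_left_comm (ι w) (ι v),
      mul_smul_comm, Complex.ofReal_neg, neg_smul, smul_neg]
    module

theorem conj_moyal (a b : SymC V) : conj (moyal τ a b) = moyal τ (conj b) (conj a) := by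
  induction a using SymC.induction generalizing b with
  | one => simp [moyal_one, moyal_one_right]
  | smul c a h => simp only [moyal_smul_left, h, conj_smul, moyal_smul_right]
  | add a a' ha hb => simp only [moyal_add_left, map_add, ha, hb, moyal_add_right]
  | ι_mul v a h =>
    simp only [moyal_ι_mul, map_add, map_mul, conj_ι, conj_smul, h, moyal_mul_ι, conj_contract]
    simp [sub_eq_add_neg, neg_div, Complex.conj_ofNat]

theorem map_moyal {τ : PoissonForm V} {σ : PoissonForm W} (f : V →ₗ[ℝ] W)
    (hf : ∀ v w, σ.form (f v) (f w) = τ.form v w) (a b : SymC V) :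
    map f (moyal τ a b) = moyal σ (map f a) (map f b) := by
  have hc : ∀ v b, map f (contract (τ.form v) b) = contract (σ.form (f v)) (map f b) := by
    intro v b
    induction b using SymC.induction with
    | one => simp
    | smul c a h => simp [h]
    | add a b ha hb => simp [ha, hb]
    | ι_mul w a h => simp [h, hf, -Complex.coe_smul]
  induction a using SymC.induction generalizing b with
  | one => simp [moyal_one]
  | smul c a h => simp only [moyal_smul_left, map_smul, h]
  | add a a' ha hb => simp only [moyal_add_left, map_add, ha, hb]
  | ι_mul v a h => simp only [moyal_ι_mul, map_add, map_mul, map_smul, map_ι, h, hc]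

theorem map_conj (f : V →ₗ[ℝ] W) (a : SymC V) : map f (conj a) = conj (map f a) := by
  induction a using SymC.induction with
  | one => simp
  | smul c a h => simp [h]
  | add a b ha hb => simp [ha, hb]
  | ι_mul w a h => simp [h]

end moyal

end SymC

/-- The CCR algebra of a Poisson vector space `(V, τ)`: the complexified symmetric algebra with
the Moyal-Weyl star product of `τ`, the unit `1` and complex conjugation as involution. -/
def CCR {V : Type*} [AddCommGroup V] [Module ℝ V] (_τ : PoissonForm V) : Type _ := SymC V

namespace CCR
variable {V W X : Type*} [AddCommGroup V] [Module ℝ V] [AddCommGroup W] [Module ℝ W]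
  [AddCommGroup X] [Module ℝ X]
variable {τ : PoissonForm V} {σ : PoissonForm W} {ρ : PoissonForm X}

instance : AddCommGroup (CCR τ) := inferInstanceAs (AddCommGroup (SymC V))
instance : Module ℂ (CCR τ) := inferInstanceAs (Module ℂ (SymC V))

instance : Ring (CCR τ) where
  __ := (inferInstance : AddCommGroup (CCR τ))
  mul := SymC.moyal τ
  one := (1 : SymC V)
  one_mul := SymC.moyal_one τ
  mul_one := SymC.moyal_one_right τ
  mul_assoc := SymC.moyal_assoc τ
  left_distrib := SymC.moyal_add_right τ
  right_distrib := SymC.moyal_add_left τ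
  zero_mul a := by
    change SymC.moyal τ 0 a = 0
    simp [SymC.moyal]
  mul_zero := SymC.moyal_zero_right τ

instance : Algebra ℂ (CCR τ) :=
  Algebra.ofModule (SymC.moyal_smul_left τ) (fun c a b => SymC.moyal_smul_right τ c a b)

instance : StarRing (CCR τ) where
  star := SymC.conj (V := V)
  star_involutive := SymC.conj_conj (V := V)
  star_mul := SymC.conj_moyal τ
  star_add := map_add (SymC.conj (V := V))

instance : StarModule ℂ (CCR τ) where
  star_smul := SymC.conj_smul (V := V)

/-- A Poisson map induces a `*`-homomorphism of CCR algebras. -/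
def map (f : V →ₗ[ℝ] W) (hf : ∀ v w, σ.form (f v) (f w) = τ.form v w) : CCR τ →⋆ₐ[ℂ] CCR σ where
  toFun := SymC.map f
  map_one' := map_one (SymC.map f)
  map_mul' := SymC.map_moyal f hf
  map_zero' := map_zero (SymC.map f)
  map_add' := map_add (SymC.map f)
  commutes' c := by
    change SymC.map f (c • 1) = c • (1 : SymC W)
    rw [map_smul, map_one]
  map_star' := SymC.map_conj f

theorem map_id (hf : ∀ v w, τ.form ((LinearMap.id : V →ₗ[ℝ] V) v) (LinearMap.id w) = τ.form v w) :
    map (τ := τ) (σ := τ) LinearMap.id hf = StarAlgHom.id ℂ (CCR τ) := by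
  ext a
  change SymC.map LinearMap.id (show SymC V from a) = a
  induction a using SymC.induction with
  | one => exact map_one _
  | smul c a h => exact (map_smul _ c a).trans (congrArg _ h)
  | add a b ha hb => exact (map_add _ a b).trans (congrArg₂ _ ha hb)
  | ι_mul w a h => exact (map_mul _ _ a).trans (congrArg₂ _ (SymC.map_ι _ _) h)

theorem map_comp (g : W →ₗ[ℝ] X) (hg : ∀ v w, ρ.form (g v) (g w) = σ.form v w)
    (f : V →ₗ[ℝ] W) (hf : ∀ v w, σ.form (f v) (f w) = τ.form v w)
    (hgf : ∀ v w, ρ.form ((g ∘ₗ f) v) ((g ∘ₗ f) w) = τ.form v w) :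
    map (g ∘ₗ f) hgf = (map g hg).comp (map f hf) := by
  ext a
  change SymC.map (g ∘ₗ f) (show SymC V from a) = SymC.map g (SymC.map f a)
  induction a using SymC.induction with
  | one => simp
  | smul c a h => simp [h]
  | add a b ha hb => simp [ha, hb]
  | ι_mul w a h => simp [h]

end CCR

/-! ### The flat cylinder -/

/-- The lattice generated by `(x⁺, x⁻) = (1, -1)` in light-cone coordinates. -/
abbrev cylLattice : AddSubgroup (ℝ × ℝ) := AddSubgroup.zmultiples (1, -1)

/-- The flat cylinder, the quotient of two-dimensional Minkowski spacetime with light-cone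
coordinates `(x⁺, x⁻)` by `(x⁺, x⁻) ∼ (x⁺ + 1, x⁻ - 1)`. -/
abbrev Cyl : Type := (ℝ × ℝ) ⧸ cylLattice

namespace Cyl

theorem mk_eq_mk {x y : ℝ × ℝ} :
    (x : Cyl) = (y : Cyl) ↔ ∃ n : ℤ, y.1 = x.1 + n ∧ y.2 = x.2 - n := by
  rw [QuotientAddGroup.eq, AddSubgroup.mem_zmultiples_iff]
  constructor
  · rintro ⟨n, hn⟩
    refine ⟨n, ?_, ?_⟩
    · have := congrArg Prod.fst hn
      simp at this; linarith
    · have := congrArg Prod.snd hn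
      simp at this; linarith
  · rintro ⟨n, h1, h2⟩
    refine ⟨n, Prod.ext ?_ ?_⟩
    · simp [h1]
    · simp [h2]; ring

theorem mk_shift (x : ℝ × ℝ) (n : ℤ) : ((x.1 + n, x.2 - n) : ℝ × ℝ) = (x : Cyl) :=
  (mk_eq_mk.2 ⟨n, rfl, rfl⟩).symm

/-- Functions on the cylinder from invariant functions on Minkowski spacetime. -/
def lift {β : Type*} (F : ℝ × ℝ → β) (hF : ∀ x (n : ℤ), F (x.1 + n, x.2 - n) = F x) : Cyl → β :=
  Quotient.lift F (fun x y h => by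
    obtain ⟨n, h1, h2⟩ := mk_eq_mk.1 (Quotient.sound h : (x : Cyl) = (y : Cyl))
    rw [← hF x n, ← h1, ← h2])

@[simp] theorem lift_mk {β : Type*} (F : ℝ × ℝ → β) (hF) (x : ℝ × ℝ) :
    lift F hF (x : Cyl) = F x := rfl

/-- The time coordinate (up to a factor) `x⁺ + x⁻` on the cylinder. -/
def time : Cyl → ℝ := lift (fun x => x.1 + x.2) (fun x n => by simp)

theorem continuous_time : Continuous time :=
  Continuous.quotient_lift (by fun_prop) _

theorem bound_of_hasCompactSupport {f : Cyl → ℝ} (hf : HasCompactSupport f) :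
    ∃ R : ℝ, ∀ x : ℝ × ℝ, R < |x.1 + x.2| → f x = 0 := by
  obtain ⟨R, hR⟩ := (hf.image continuous_time).isBounded.exists_norm_le
  refine ⟨R, fun x hx => ?_⟩
  by_contra h
  have := hR _ ⟨(x : Cyl), subset_tsupport f h, rfl⟩
  exact absurd this (not_le.2 hx)

theorem hasCompactSupport_of_bound {f : Cyl → ℝ} {R : ℝ}
    (hf : ∀ x : ℝ × ℝ, R < |x.1 + x.2| → f x = 0) : HasCompactSupport f := by
  have hK : IsCompact ((fun x : ℝ × ℝ => (x : Cyl)) ''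
      (Set.Icc (0 : ℝ) 1 ×ˢ Set.Icc (-R - 1) R)) :=
    (isCompact_Icc.prod isCompact_Icc).image continuous_quot_mk
  have hC : IsClosed {p : Cyl | |time p| ≤ R} :=
    isClosed_le (continuous_time.abs) continuous_const
  refine hK.of_isClosed_subset (isClosed_tsupport f) ?_
  refine (closure_minimal ?_ hC).trans ?_
  · intro p hp
    induction p using QuotientAddGroup.induction_on with
    | H x =>
      by_contra hx
      exact hp (hf x (not_le.1 hx))
  · intro p hp
    induction p using QuotientAddGroup.induction_on with
    | H x =>
      have hx : |x.1 + x.2| ≤ R := hp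
      have h0 := Int.fract_nonneg x.1
      have h1 := Int.fract_lt_one x.1
      have h2 := Int.floor_add_fract x.1
      obtain ⟨h3, h4⟩ := abs_le.1 hx
      refine ⟨(Int.fract x.1, x.2 + ⌊x.1⌋), ⟨⟨h0, h1.le⟩, ?_, ?_⟩, ?_⟩
      · simp only; linarith
      · simp only; linarith
      · refine mk_eq_mk.2 ⟨⌊x.1⌋, ?_, ?_⟩ <;> simp only <;> linarith

/-- The derivative of a function on the cylinder along a constant vector field `e`. -/
def dirDeriv (e : ℝ × ℝ) (f : Cyl → ℝ) (p : Cyl) : ℝ :=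
  deriv (fun t : ℝ => f (p + ((t • e : ℝ × ℝ) : Cyl))) 0

theorem dirDeriv_mk (e : ℝ × ℝ) {f : Cyl → ℝ} (hf : ContDiff ℝ ∞ (fun x : ℝ × ℝ => f x))
    (x : ℝ × ℝ) : dirDeriv e f x = fderiv ℝ (fun x : ℝ × ℝ => f x) x e := by
  have h1 : HasFDerivAt (fun x : ℝ × ℝ => f x) (fderiv ℝ (fun x : ℝ × ℝ => f x) x)
      (x + (0 : ℝ) • e) := by
    rw [zero_smul, add_zero]
    exact (hf.differentiable (by simp) x).hasFDerivAt
  have h2 : HasDerivAt (fun t : ℝ => x + t • e) e 0 := by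
    simpa using ((hasDerivAt_id (0 : ℝ)).smul_const e).const_add x
  exact (h1.comp_hasDerivAt (0 : ℝ) h2).deriv

end Cyl

/-- Smooth functions with compact support on the cylinder, as a space of functions. -/
def ccCyl : Submodule ℝ (Cyl → ℝ) where
  carrier := {f | ContDiff ℝ ∞ (fun x : ℝ × ℝ => f x) ∧ HasCompactSupport f}
  zero_mem' := ⟨contDiff_const, HasCompactSupport.zero⟩
  add_mem' hf hg := ⟨hf.1.add hg.1, hf.2.add hg.2⟩
  smul_mem' c _ hf := ⟨hf.1.const_smul c, hf.2.smul_left (f := fun _ => c)⟩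

/-- Smooth functions with compact support on the cylinder. -/
abbrev CcCyl : Type := ccCyl

namespace CcCyl

theorem smooth (f : CcCyl) : ContDiff ℝ ∞ (fun x : ℝ × ℝ => f.1 x) := f.2.1

theorem exists_bound (f : CcCyl) : ∃ R : ℝ, ∀ x : ℝ × ℝ, R < |x.1 + x.2| → f.1 x = 0 :=
  Cyl.bound_of_hasCompactSupport f.2.2

/-- The derivative along a constant vector field as an operator on test functions. -/
def along (e : ℝ × ℝ) : CcCyl →ₗ[ℝ] CcCyl where
  toFun f := ⟨Cyl.dirDeriv e f.1, by
    refine ⟨?_, ?_⟩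
    · have : (fun x : ℝ × ℝ => Cyl.dirDeriv e f.1 x)
          = fun x => fderiv ℝ (fun x : ℝ × ℝ => f.1 x) x e :=
        funext fun x => Cyl.dirDeriv_mk e f.smooth x
      rw [this]
      exact (f.smooth.fderiv_right (m := ∞) (by simp)).clm_apply contDiff_const
    · obtain ⟨R, hR⟩ := f.exists_bound
      refine Cyl.hasCompactSupport_of_bound (R := R) fun x hx => ?_
      rw [Cyl.dirDeriv_mk e f.smooth x]
      have : (fun x : ℝ × ℝ => f.1 x) =ᶠ[nhds x] fun _ => 0 := by
        have ho : IsOpen {x : ℝ × ℝ | R < |x.1 + x.2|} :=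
          isOpen_lt continuous_const (by fun_prop)
        filter_upwards [ho.mem_nhds hx] with y hy using hR y hy
      rw [this.fderiv_eq]
      simp⟩
  map_add' f g := by
    ext p
    induction p using QuotientAddGroup.induction_on with
    | H x =>
      change Cyl.dirDeriv e (f.1 + g.1) x = Cyl.dirDeriv e f.1 x + Cyl.dirDeriv e g.1 x
      rw [Cyl.dirDeriv_mk e f.smooth, Cyl.dirDeriv_mk e g.smooth,
        Cyl.dirDeriv_mk e (f := f.1 + g.1) (f + g).smooth]
      have := fderiv_add (f.smooth.differentiable (by simp) x)
        (g.smooth.differentiable (by simp) x)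
      exact congrArg (fun L => L e) this
  map_smul' c f := by
    ext p
    induction p using QuotientAddGroup.induction_on with
    | H x =>
      change Cyl.dirDeriv e (c • f.1) x = c * Cyl.dirDeriv e f.1 x
      rw [Cyl.dirDeriv_mk e f.smooth, Cyl.dirDeriv_mk e (f := c • f.1) (c • f).smooth]
      have := fderiv_const_smul (f.smooth.differentiable (by simp) x) c
      exact congrArg (fun L => L e) this

/-- The partial derivative `∂₊` along the light-cone coordinate `x⁺`. -/
def dPlus : CcCyl →ₗ[ℝ] CcCyl := along (1, 0)

/-- The partial derivative `∂₋` along the light-cone coordinate `x⁻`. -/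
def dMinus : CcCyl →ₗ[ℝ] CcCyl := along (0, 1)

theorem hasDerivAt_plus (f : CcCyl) (u v : ℝ) :
    HasDerivAt (fun u : ℝ => f.1 ((u, v) : ℝ × ℝ)) ((dPlus f).1 ((u, v) : ℝ × ℝ)) u := by
  have h1 := (f.smooth.differentiable (by simp) (u, v)).hasFDerivAt
  have h2 : HasDerivAt (fun u : ℝ => ((u, v) : ℝ × ℝ)) (1, 0) u :=
    (hasDerivAt_id u).prodMk (hasDerivAt_const u v)
  have := h1.comp_hasDerivAt u h2
  rwa [← Cyl.dirDeriv_mk _ f.smooth] at this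

theorem hasDerivAt_minus (f : CcCyl) (u v : ℝ) :
    HasDerivAt (fun v : ℝ => f.1 ((u, v) : ℝ × ℝ)) ((dMinus f).1 ((u, v) : ℝ × ℝ)) v := by
  have h1 := (f.smooth.differentiable (by simp) (u, v)).hasFDerivAt
  have h2 : HasDerivAt (fun v : ℝ => ((u, v) : ℝ × ℝ)) (0, 1) v :=
    (hasDerivAt_const v u).prodMk (hasDerivAt_id v)
  have := h1.comp_hasDerivAt v h2
  rwa [← Cyl.dirDeriv_mk _ f.smooth] at this

theorem bounded (f : CcCyl) : ∃ C : ℝ, ∀ p, |f.1 p| ≤ C := by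
  have hc : Continuous f.1 := continuous_coinduced_dom.2 f.smooth.continuous
  obtain ⟨C, hC⟩ := hc.bounded_above_of_compact_support f.2.2
  exact ⟨C, hC⟩

/-! #### Swapping the two light-cone coordinates -/

/-- Reflection of a test function in the two light-cone coordinates. -/
def swap (f : CcCyl) : CcCyl :=
  ⟨Cyl.lift (fun x => f.1 ((x.2, x.1) : ℝ × ℝ)) (fun x n => by
    have := Cyl.mk_shift (x.2, x.1) (-n)
    simp only [Int.cast_neg, sub_neg_eq_add, ← sub_eq_add_neg] at this
    simp only [this]), by
    refine ⟨f.smooth.comp (contDiff_snd.prodMk contDiff_fst), ?_⟩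
    obtain ⟨R, hR⟩ := f.exists_bound
    refine Cyl.hasCompactSupport_of_bound (R := R) fun x hx => ?_
    exact hR (x.2, x.1) (by rwa [add_comm] at hx)⟩

theorem swap_mk (f : CcCyl) (u v : ℝ) :
    (swap f).1 ((u, v) : ℝ × ℝ) = f.1 ((v, u) : ℝ × ℝ) := rfl

theorem dPlus_swap (f : CcCyl) : dPlus (swap f) = swap (dMinus f) := by
  ext p
  induction p using QuotientAddGroup.induction_on with
  | H x =>
    obtain ⟨u, v⟩ := x
    exact (hasDerivAt_plus (swap f) u v).unique (hasDerivAt_minus f v u)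

theorem dMinus_swap (f : CcCyl) : dMinus (swap f) = swap (dPlus f) := by
  ext p
  induction p using QuotientAddGroup.induction_on with
  | H x =>
    obtain ⟨u, v⟩ := x
    exact (hasDerivAt_minus (swap f) u v).unique (hasDerivAt_plus f v u)

end CcCyl

/-- Smooth functions on the circle `𝕋 = ℝ/ℤ`, as a space of functions. -/
def smoothCircle : Submodule ℝ (UnitAddCircle → ℝ) where
  carrier := {f | ContDiff ℝ ∞ (fun x : ℝ => f x)}
  zero_mem' := (contDiff_const : ContDiff ℝ ∞ fun _ : ℝ => (0 : ℝ))
  add_mem' {f g} (hf : ContDiff ℝ ∞ fun x : ℝ => f x) (hg : ContDiff ℝ ∞ fun x : ℝ => g x) :=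
    hf.add hg
  smul_mem' c f (hf : ContDiff ℝ ∞ fun x : ℝ => f x) := hf.const_smul c

/-- Smooth functions on the circle `𝕋 = ℝ/ℤ`. -/
abbrev SmoothCircle : Type := smoothCircle

namespace SmoothCircle

theorem smooth (f : SmoothCircle) : ContDiff ℝ ∞ (fun x : ℝ => f.1 x) := f.2

theorem hasDerivAt (f : SmoothCircle) (x : ℝ) :
    HasDerivAt (fun x : ℝ => f.1 x) (deriv (fun x : ℝ => f.1 x) x) x :=
  (f.smooth.differentiable (by simp) x).hasDerivAt

theorem continuous_deriv (f : SmoothCircle) : Continuous (deriv (fun x : ℝ => f.1 x)) :=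
  f.smooth.continuous_deriv (by simp)

theorem periodic (f : SmoothCircle) : Function.Periodic (fun x : ℝ => f.1 x) 1 := fun x => by
  simp only [AddCircle.coe_add_period]

/-- The form `τ(φ, ψ) = -½ ∫_𝕋 φ dψ` on smooth functions on the circle. -/
def poisson : PoissonForm SmoothCircle where
  form := LinearMap.mk₂ ℝ
    (fun φ ψ => -(1 / 2) * ∫ x in (0 : ℝ)..1, φ.1 x * deriv (fun y : ℝ => ψ.1 y) x)
    (fun φ φ' ψ => by
      rw [← mul_add, ← intervalIntegral.integral_add]
      · simp [add_mul]
      all_goals exact ((smooth _).continuous.mul ψ.continuous_deriv).intervalIntegrable _ _)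
    (fun c φ ψ => by
      simp only [Submodule.coe_smul, Pi.smul_apply, smul_eq_mul, mul_assoc]
      rw [intervalIntegral.integral_const_mul]
      ring)
    (fun φ ψ ψ' => by
      rw [← mul_add, ← intervalIntegral.integral_add]
      · congr 2
        ext x
        have : deriv (fun y : ℝ => (ψ + ψ').1 y) x = _ := ((ψ.hasDerivAt x).add (ψ'.hasDerivAt x)).deriv
        rw [this, mul_add]
      all_goals exact (φ.smooth.continuous.mul (continuous_deriv _)).intervalIntegrable _ _)
    (fun c φ ψ => by
      have : ∀ x, deriv (fun y : ℝ => (c • ψ).1 y) x = c * deriv (fun y : ℝ => ψ.1 y) x :=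
        fun x => ((ψ.hasDerivAt x).const_mul c).deriv
      simp only [this, smul_eq_mul, mul_left_comm _ c]
      rw [intervalIntegral.integral_const_mul]
      ring)
  alt φ := by
    have h : ∫ x in (0 : ℝ)..1, (deriv (fun y : ℝ => φ.1 y) x * φ.1 x
        + φ.1 x * deriv (fun y : ℝ => φ.1 y) x) = φ.1 (1 : ℝ) * φ.1 (1 : ℝ) - φ.1 (0 : ℝ) * φ.1 (0 : ℝ) :=
      intervalIntegral.integral_eq_sub_of_hasDerivAt
        (f := fun x : ℝ => φ.1 x * φ.1 x) (fun x _ => (φ.hasDerivAt x).mul (φ.hasDerivAt x))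
        (((φ.continuous_deriv.mul φ.smooth.continuous).add
          (φ.smooth.continuous.mul φ.continuous_deriv)).intervalIntegrable _ _)
    have hp := φ.periodic 0
    simp only [zero_add] at hp
    rw [hp, sub_self] at h
    have h2 : ∀ x : ℝ, deriv (fun y : ℝ => φ.1 y) x * φ.1 x
        + φ.1 x * deriv (fun y : ℝ => φ.1 y) x = 2 * (φ.1 x * deriv (fun y : ℝ => φ.1 y) x) :=
      fun x => by ring
    simp only [h2] at h
    rw [intervalIntegral.integral_const_mul] at h
    simp only [LinearMap.mk₂_apply]
    linarith

theorem poisson_apply (φ ψ : SmoothCircle) : poisson.form φ ψ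
    = -(1 / 2) * ∫ x in (0 : ℝ)..1, φ.1 x * deriv (fun y : ℝ => ψ.1 y) x := rfl

end SmoothCircle

/-! ### Fiber integration along light rays -/

namespace CcCyl

open MeasureTheory

theorem continuous_mk (f : CcCyl) : Continuous (fun x : ℝ × ℝ => f.1 x) := f.smooth.continuous

theorem slice_smooth (f : CcCyl) (u : ℝ) : ContDiff ℝ ∞ (fun v : ℝ => f.1 ((u, v) : ℝ × ℝ)) :=
  f.smooth.comp (contDiff_const.prodMk contDiff_id)

theorem slice_compact (f : CcCyl) (u : ℝ) :
    HasCompactSupport (fun v : ℝ => f.1 ((u, v) : ℝ × ℝ)) := by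
  obtain ⟨R, hR⟩ := f.exists_bound
  refine HasCompactSupport.intro (isCompact_Icc (a := -R - u) (b := R - u)) fun v hv => ?_
  apply hR
  by_contra h
  obtain ⟨h1, h2⟩ := abs_le.1 (not_lt.1 h)
  simp only at h1 h2
  exact hv ⟨by linarith, by linarith⟩

theorem slice_integrable (f : CcCyl) (u : ℝ) :
    Integrable (fun v : ℝ => f.1 ((u, v) : ℝ × ℝ)) :=
  (f.slice_smooth u).continuous.integrable_of_hasCompactSupport (f.slice_compact u)

theorem slice_deriv (f : CcCyl) (u : ℝ) :
    deriv (fun v : ℝ => f.1 ((u, v) : ℝ × ℝ)) = fun v => (dMinus f).1 ((u, v) : ℝ × ℝ) :=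
  funext fun v => (hasDerivAt_minus f u v).deriv

theorem integral_dMinus (f : CcCyl) (u : ℝ) : ∫ v, (dMinus f).1 ((u, v) : ℝ × ℝ) = 0 :=
  integral_eq_zero_of_hasDerivAt_of_integrable (hasDerivAt_minus f u)
    ((dMinus f).slice_integrable u) (f.slice_integrable u)

theorem hasDerivAt_fiber (f : CcCyl) (u : ℝ) :
    HasDerivAt (fun u : ℝ => ∫ v, f.1 ((u, v) : ℝ × ℝ)) (∫ v, (dPlus f).1 ((u, v) : ℝ × ℝ)) u := by
  obtain ⟨R, hR⟩ := (dPlus f).exists_bound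
  obtain ⟨C, hC⟩ := (dPlus f).bounded
  have h0 : (0 : ℝ) ≤ C := (abs_nonneg _).trans (hC 0)
  refine (hasDerivAt_integral_of_dominated_loc_of_deriv_le (μ := volume)
    (F := fun u v => f.1 ((u, v) : ℝ × ℝ)) (F' := fun u v => (dPlus f).1 ((u, v) : ℝ × ℝ))
    (s := Metric.ball u 1)
    (bound := (Set.Icc (-R - u - 1) (R - u + 1)).indicator (fun _ => C))
    (Metric.ball_mem_nhds u one_pos) ?_ ?_ ?_ ?_ ?_ ?_).2
  · exact Filter.Eventually.of_forall fun x =>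
      (f.slice_smooth x).continuous.aestronglyMeasurable
  · exact f.slice_integrable u
  · exact ((dPlus f).slice_smooth u).continuous.aestronglyMeasurable
  · refine Filter.Eventually.of_forall fun v x hx => ?_
    by_cases hv : v ∈ Set.Icc (-R - u - 1) (R - u + 1)
    · rw [Set.indicator_of_mem hv]; exact hC _
    · rw [Set.indicator_of_notMem hv, hR, norm_zero]
      by_contra h
      obtain ⟨h1, h2⟩ := abs_le.1 (not_lt.1 h)
      rw [Metric.mem_ball, Real.dist_eq] at hx
      obtain ⟨h3, h4⟩ := abs_lt.1 hx
      simp only at h1 h2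
      exact hv ⟨by linarith, by linarith⟩
  · exact (integrable_indicator_iff measurableSet_Icc).2
      (integrableOn_const (by simp))
  · exact Filter.Eventually.of_forall fun v x _ => hasDerivAt_plus f x v

theorem fiber_contDiff (n : ℕ) : ∀ f : CcCyl,
    ContDiff ℝ n (fun u : ℝ => ∫ v, f.1 ((u, v) : ℝ × ℝ)) := by
  induction n with
  | zero =>
    intro f
    exact contDiff_zero.2 (continuous_iff_continuousAt.2 fun u =>
      (hasDerivAt_fiber f u).continuousAt)
  | succ n ih =>
    intro f
    have hd : deriv (fun u : ℝ => ∫ v, f.1 ((u, v) : ℝ × ℝ))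
        = fun u => ∫ v, (dPlus f).1 ((u, v) : ℝ × ℝ) :=
      funext fun u => (hasDerivAt_fiber f u).deriv
    push_cast
    refine contDiff_succ_iff_deriv.2 ⟨fun u => (hasDerivAt_fiber f u).differentiableAt, ?_, ?_⟩
    · intro h; simp at h
    · rw [hd]; exact ih _

/-- Integration of a test function along the light rays `x⁺ = const`, a function of `x⁺`. -/
def fiberPlus : CcCyl →ₗ[ℝ] SmoothCircle where
  toFun f := ⟨Function.Periodic.lift (f := fun u : ℝ => ∫ v, f.1 ((u, v) : ℝ × ℝ)) (c := 1)
    (fun u => by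
      refine (integral_sub_right_eq_self (fun v => f.1 ((u + 1, v) : ℝ × ℝ)) (1 : ℝ)).symm.trans ?_
      refine integral_congr_ae (Filter.Eventually.of_forall fun v => ?_)
      have := Cyl.mk_shift (u, v) 1
      simp only [Int.cast_one] at this
      simp only [this]),
    contDiff_infty.2 fun n => fiber_contDiff n f⟩
  map_add' f g := by
    ext p
    induction p using QuotientAddGroup.induction_on with
    | H u => exact integral_add (f.slice_integrable u) (g.slice_integrable u)
  map_smul' c f := by
    ext p
    induction p using QuotientAddGroup.induction_on with
    | H u => exact integral_const_mul c _

theorem fiberPlus_coe (f : CcCyl) (u : ℝ) :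
    (fiberPlus f).1 (u : UnitAddCircle) = ∫ v, f.1 ((u, v) : ℝ × ℝ) := rfl

/-- Integration of a test function along the light rays `x⁻ = const`, a function of `x⁻`. -/
def fiberMinus : CcCyl →ₗ[ℝ] SmoothCircle where
  toFun f := fiberPlus (swap f)
  map_add' f g := by
    have : swap (f + g) = swap f + swap g := by
      ext p
      induction p using QuotientAddGroup.induction_on with
      | H x => rfl
    rw [this, map_add]
  map_smul' c f := by
    have : swap (c • f) = c • swap f := by
      ext p
      induction p using QuotientAddGroup.induction_on with
      | H x => rfl
    rw [this, map_smul]; rfl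

theorem fiberMinus_coe (f : CcCyl) (v : ℝ) :
    (fiberMinus f).1 (v : UnitAddCircle) = ∫ u, f.1 ((u, v) : ℝ × ℝ) := rfl

theorem fiberMinus_eq (f : CcCyl) : fiberMinus f = fiberPlus (swap f) := rfl

theorem fiberPlus_dMinus (f : CcCyl) : fiberPlus (dMinus f) = 0 := by
  ext p
  induction p using QuotientAddGroup.induction_on with
  | H u => exact integral_dMinus f u

theorem fiberMinus_dPlus (f : CcCyl) : fiberMinus (dPlus f) = 0 := by
  rw [fiberMinus_eq, ← dMinus_swap, fiberPlus_dMinus]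

theorem fiberPlus_dPlus (f : CcCyl) (u : ℝ) :
    (fiberPlus (dPlus f)).1 (u : UnitAddCircle)
      = deriv (fun u : ℝ => (fiberPlus f).1 (u : UnitAddCircle)) u :=
  (hasDerivAt_fiber f u).deriv.symm

theorem fiberMinus_dMinus (f : CcCyl) (v : ℝ) :
    (fiberMinus (dMinus f)).1 (v : UnitAddCircle)
      = deriv (fun v : ℝ => (fiberMinus f).1 (v : UnitAddCircle)) v := by
  rw [fiberMinus_eq, ← dPlus_swap, fiberPlus_dPlus, fiberMinus_eq]

end CcCyl

/-! ### One-forms, the Hodge operator and the linear observables -/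

/-- Compactly supported one-forms on the cylinder; the pair `(a, b)` of component functions stands
for `a dx⁺ + b dx⁻` (the forms `dx⁺`, `dx⁻` are a global frame). -/
abbrev OneForm : Type := CcCyl × CcCyl

/-- The Hodge operator on one-forms for the metric `½ (dx⁺ ⊗ dx⁻ + dx⁻ ⊗ dx⁺)` and the orientation
`dx⁻ ∧ dx⁺`, that is `∗ dx⁺ = dx⁺` and `∗ dx⁻ = - dx⁻`. -/
def hodge : OneForm →ₗ[ℝ] OneForm := LinearMap.prodMap LinearMap.id (-LinearMap.id)

/-- The de Rham differential on functions, `f ↦ ∂₊f dx⁺ + ∂₋f dx⁻`. -/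
def dFun : CcCyl →ₗ[ℝ] OneForm := CcCyl.dPlus.prod CcCyl.dMinus

/-- The de Rham differential on one-forms; a two-form `ρ dx⁻ ∧ dx⁺` is represented by its
coefficient function `ρ`, so `d (a dx⁺ + b dx⁻)` is represented by `∂₋a - ∂₊b`. -/
def dForm : OneForm →ₗ[ℝ] CcCyl :=
  CcCyl.dMinus ∘ₗ LinearMap.fst ℝ CcCyl CcCyl - CcCyl.dPlus ∘ₗ LinearMap.snd ℝ CcCyl CcCyl

/-- The subspace `d C_c^∞ + ∗ d C_c^∞` of one-forms. -/
def trivialForms : Submodule ℝ OneForm := LinearMap.range dFun ⊔ LinearMap.range (hodge ∘ₗ dFun)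

/-- The linear observables of the Abelian current on the flat cylinder,
`Ω_c¹ / (d C_c^∞ + ∗ d C_c^∞)`. -/
abbrev LinObs : Type := OneForm ⧸ trivialForms

/-! ### The causal propagator and the Poisson structure -/

open MeasureTheory in
/-- The causal propagator `G = G⁺ - G⁻` of `P = d ∗ d = 2 dx⁻ ∧ dx⁺ ∂₋∂₊` on the cylinder, applied
to the two-form `ρ dx⁻ ∧ dx⁺`. The retarded Green operator `G⁺` integrates `ρ / 2` over the causal
past of `p`, the advanced one `G⁻` over the causal future. Past and future of `p` are taken in
Minkowski spacetime, the universal cover of the cylinder (method of images): with respect to the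
product order on light-cone coordinates they are `p + {y ≤ 0}` and `p + {y ≥ 0}`. -/
def causalProp (ρ : CcCyl) (p : Cyl) : ℝ :=
  (1 / 2) * (∫ y in Set.Iic (0 : ℝ × ℝ), ρ.1 (p + (y : Cyl)))
    - (1 / 2) * ∫ y in Set.Ici (0 : ℝ × ℝ), ρ.1 (p + (y : Cyl))

open MeasureTheory in
/-- Integration of the two-form `F dx⁻ ∧ dx⁺` over the cylinder, using the fundamental domain
`0 ≤ x⁺ < 1`. -/
def cylIntegral (F : Cyl → ℝ) : ℝ := ∫ x in Set.Ico (0 : ℝ) 1 ×ˢ (Set.univ : Set ℝ), F (x : Cyl)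

/-- The pairing `∫ dα G(dβ)` of one-forms. -/
def tauForm (α β : OneForm) : ℝ :=
  cylIntegral fun p => (dForm α).1 p * causalProp (dForm β) p

namespace CcCyl

open MeasureTheory

theorem integrableOn_past (f : CcCyl) (x : ℝ × ℝ) :
    IntegrableOn (fun z : ℝ × ℝ => f.1 ((x + z : ℝ × ℝ) : Cyl)) (Set.Iic 0) := by
  obtain ⟨R, hR⟩ := f.exists_bound
  have hc : Continuous (fun z : ℝ × ℝ => f.1 ((x + z : ℝ × ℝ) : Cyl)) :=
    f.continuous_mk.comp (continuous_const.add continuous_id)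
  set K := -R - x.1 - x.2
  have h1 : IntegrableOn (fun z : ℝ × ℝ => f.1 ((x + z : ℝ × ℝ) : Cyl))
      (Set.Icc ((K, K) : ℝ × ℝ) 0) := hc.continuousOn.integrableOn_compact isCompact_Icc
  refine h1.of_forall_sdiff_eq_zero measurableSet_Iic fun z hz => hR _ ?_
  by_contra h
  obtain ⟨h2, h3⟩ := abs_le.1 (not_lt.1 h)
  obtain ⟨h4, h5⟩ := Prod.le_def.1 (Set.mem_Iic.1 hz.1)
  simp only [Prod.fst_add, Prod.snd_add, Prod.fst_zero, Prod.snd_zero] at h2 h3 h4 h5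
  exact hz.2 ⟨Prod.le_def.2 ⟨by simp only [K]; linarith, by simp only [K]; linarith⟩, hz.1⟩

theorem integrableOn_future (f : CcCyl) (x : ℝ × ℝ) :
    IntegrableOn (fun z : ℝ × ℝ => f.1 ((x + z : ℝ × ℝ) : Cyl)) (Set.Ici 0) := by
  obtain ⟨R, hR⟩ := f.exists_bound
  have hc : Continuous (fun z : ℝ × ℝ => f.1 ((x + z : ℝ × ℝ) : Cyl)) :=
    f.continuous_mk.comp (continuous_const.add continuous_id)
  set K := R - x.1 - x.2
  have h1 : IntegrableOn (fun z : ℝ × ℝ => f.1 ((x + z : ℝ × ℝ) : Cyl))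
      (Set.Icc (0 : ℝ × ℝ) (K, K)) := hc.continuousOn.integrableOn_compact isCompact_Icc
  refine h1.of_forall_sdiff_eq_zero measurableSet_Ici fun z hz => hR _ ?_
  by_contra h
  obtain ⟨h2, h3⟩ := abs_le.1 (not_lt.1 h)
  obtain ⟨h4, h5⟩ := Prod.le_def.1 (Set.mem_Ici.1 hz.1)
  simp only [Prod.fst_add, Prod.snd_add, Prod.fst_zero, Prod.snd_zero] at h2 h3 h4 h5
  exact hz.2 ⟨hz.1, Prod.le_def.2 ⟨by simp only [K]; linarith, by simp only [K]; linarith⟩⟩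

theorem past_dMinus (f : CcCyl) (x : ℝ × ℝ) :
    ∫ z in Set.Iic (0 : ℝ × ℝ), (dMinus f).1 ((x + z : ℝ × ℝ) : Cyl)
      = ∫ s in Set.Iic (0 : ℝ), f.1 ((x.1 + s, x.2) : ℝ × ℝ) := by
  have hi := (dMinus f).integrableOn_past x
  rw [Set.Iic_prod_eq] at hi ⊢
  rw [Measure.volume_eq_prod, setIntegral_prod _ hi]
  refine integral_congr_ae (Filter.Eventually.of_forall fun s => ?_)
  have hs : HasCompactSupport ((fun v : ℝ => f.1 ((x.1 + s, v) : ℝ × ℝ)) ∘ (fun y => x.2 + id y)) :=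
    (f.slice_compact (x.1 + s)).comp_homeomorph (Homeomorph.addLeft x.2)
  have h1 := HasCompactSupport.integral_Iic_deriv_eq
    (((f.slice_smooth (x.1 + s)).of_le (by simp)).comp (contDiff_const.add contDiff_id)) hs 0
  have h2 : deriv ((fun v : ℝ => f.1 ((x.1 + s, v) : ℝ × ℝ)) ∘ (fun y => x.2 + id y))
      = fun t => (dMinus f).1 ((x.1 + s, x.2 + t) : ℝ × ℝ) := by
    funext t
    exact ((hasDerivAt_minus f (x.1 + s) (x.2 + t)).comp_const_add x.2 t).deriv
  rw [h2] at h1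
  simp only [Function.comp_apply, id, add_zero] at h1
  exact h1

theorem future_dMinus (f : CcCyl) (x : ℝ × ℝ) :
    ∫ z in Set.Ici (0 : ℝ × ℝ), (dMinus f).1 ((x + z : ℝ × ℝ) : Cyl)
      = - ∫ s in Set.Ici (0 : ℝ), f.1 ((x.1 + s, x.2) : ℝ × ℝ) := by
  have hi := (dMinus f).integrableOn_future x
  rw [Set.Ici_prod_eq] at hi ⊢
  rw [Measure.volume_eq_prod, setIntegral_prod _ hi, ← integral_neg]
  refine integral_congr_ae (Filter.Eventually.of_forall fun s => ?_)
  have hs : HasCompactSupport ((fun v : ℝ => f.1 ((x.1 + s, v) : ℝ × ℝ)) ∘ (fun y => x.2 + id y)) :=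
    (f.slice_compact (x.1 + s)).comp_homeomorph (Homeomorph.addLeft x.2)
  have h1 := HasCompactSupport.integral_Ioi_deriv_eq
    (((f.slice_smooth (x.1 + s)).of_le (by simp)).comp (contDiff_const.add contDiff_id)) hs 0
  have h2 : deriv ((fun v : ℝ => f.1 ((x.1 + s, v) : ℝ × ℝ)) ∘ (fun y => x.2 + id y))
      = fun t => (dMinus f).1 ((x.1 + s, x.2 + t) : ℝ × ℝ) := by
    funext t
    exact ((hasDerivAt_minus f (x.1 + s) (x.2 + t)).comp_const_add x.2 t).deriv
  rw [h2, ← integral_Ici_eq_integral_Ioi] at h1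
  simp only [Function.comp_apply, id, add_zero] at h1
  exact h1

theorem past_swap (f : CcCyl) (x : ℝ × ℝ) :
    ∫ z in Set.Iic (0 : ℝ × ℝ), (swap f).1 ((x.swap + z : ℝ × ℝ) : Cyl)
      = ∫ z in Set.Iic (0 : ℝ × ℝ), f.1 ((x + z : ℝ × ℝ) : Cyl) := by
  rw [Set.Iic_prod_eq, Measure.volume_eq_prod]
  exact setIntegral_prod_swap (Set.Iic (0 : ℝ)) (Set.Iic (0 : ℝ))
    (fun z : ℝ × ℝ => f.1 ((x + z : ℝ × ℝ) : Cyl))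

theorem future_swap (f : CcCyl) (x : ℝ × ℝ) :
    ∫ z in Set.Ici (0 : ℝ × ℝ), (swap f).1 ((x.swap + z : ℝ × ℝ) : Cyl)
      = ∫ z in Set.Ici (0 : ℝ × ℝ), f.1 ((x + z : ℝ × ℝ) : Cyl) := by
  rw [Set.Ici_prod_eq, Measure.volume_eq_prod]
  exact setIntegral_prod_swap (Set.Ici (0 : ℝ)) (Set.Ici (0 : ℝ))
    (fun z : ℝ × ℝ => f.1 ((x + z : ℝ × ℝ) : Cyl))

theorem fiberMinus_split (f : CcCyl) (x : ℝ × ℝ) :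
    (∫ s in Set.Iic (0 : ℝ), f.1 ((x.1 + s, x.2) : ℝ × ℝ))
      + ∫ s in Set.Ici (0 : ℝ), f.1 ((x.1 + s, x.2) : ℝ × ℝ)
      = (fiberMinus f).1 (x.2 : UnitAddCircle) := by
  have hi : Integrable (fun s : ℝ => f.1 ((x.1 + s, x.2) : ℝ × ℝ)) :=
    ((swap f).slice_integrable x.2).comp_add_left x.1
  rw [integral_Ici_eq_integral_Ioi,
    intervalIntegral.integral_Iic_add_Ioi hi.integrableOn hi.integrableOn, fiberMinus_coe]
  exact integral_add_left_eq_self (fun s : ℝ => f.1 ((s, x.2) : ℝ × ℝ)) x.1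

/-- The causal propagator of `∂₋f` is half the integral of `f` over light rays. -/
theorem causalProp_dMinus (f : CcCyl) (x : ℝ × ℝ) :
    causalProp (dMinus f) x = (1 / 2) * (fiberMinus f).1 (x.2 : UnitAddCircle) := by
  have h1 := past_dMinus f x
  have h2 := future_dMinus f x
  rw [← fiberMinus_split f x, causalProp]
  simp only [QuotientAddGroup.mk_add] at h1 h2
  rw [h1, h2]
  ring

theorem causalProp_swap (f : CcCyl) (x : ℝ × ℝ) : causalProp (swap f) x.swap = causalProp f x := by
  have h1 := past_swap f x
  have h2 := future_swap f x
  simp only [QuotientAddGroup.mk_add] at h1 h2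
  rw [causalProp, causalProp, h1, h2]

theorem causalProp_dPlus (f : CcCyl) (x : ℝ × ℝ) :
    causalProp (dPlus f) x = (1 / 2) * (fiberPlus f).1 (x.1 : UnitAddCircle) := by
  rw [← causalProp_swap, ← dMinus_swap, causalProp_dMinus]
  rfl

theorem causalProp_sub (f g : CcCyl) (x : ℝ × ℝ) :
    causalProp (f - g) x = causalProp f x - causalProp g x := by
  have h1 := integral_sub (f.integrableOn_past x) (g.integrableOn_past x)
  have h2 := integral_sub (f.integrableOn_future x) (g.integrableOn_future x)
  simp only [QuotientAddGroup.mk_add] at h1 h2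
  simp only [causalProp, Submodule.coe_sub, Pi.sub_apply]
  rw [h1, h2]
  ring

theorem causalProp_dForm (β : OneForm) (x : ℝ × ℝ) :
    causalProp (dForm β) x = (1 / 2) * ((fiberMinus β.1).1 (x.2 : UnitAddCircle)
      - (fiberPlus β.2).1 (x.1 : UnitAddCircle)) := by
  have : dForm β = dMinus β.1 - dPlus β.2 := rfl
  rw [this, causalProp_sub, causalProp_dMinus, causalProp_dPlus]
  ring

end CcCyl

namespace Cyl

open MeasureTheory

theorem existsUnique_shift (t : ℝ) : ∃! n : ℤ, t + n ∈ Set.Ico (0 : ℝ) 1 := by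
  refine ⟨-⌊t⌋, ?_, fun n hn => ?_⟩
  · have h1 := Int.floor_le t
    have h2 := Int.lt_floor_add_one t
    constructor <;> push_cast <;> linarith
  · have : ⌊t + n⌋ = 0 := Int.floor_eq_zero_iff.2 hn
    rw [Int.floor_add_intCast] at this
    omega

theorem generator_injective :
    Function.Injective (fun n : ℤ => (⟨n • (1, -1), n, rfl⟩ : cylLattice)) := by
  intro m n h
  have := congrArg (fun g : cylLattice => g.1.1) h
  simpa using this

theorem isAddFundamentalDomain_plus :
    IsAddFundamentalDomain cylLattice (Set.Ico (0 : ℝ) 1 ×ˢ (Set.univ : Set ℝ)) := by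
  refine IsAddFundamentalDomain.mk' (measurableSet_Ico.prod MeasurableSet.univ).nullMeasurableSet
    fun x => ?_
  obtain ⟨n, hn, hu⟩ := existsUnique_shift x.1
  refine ⟨⟨n • (1, -1), n, rfl⟩, ⟨?_, trivial⟩, ?_⟩
  · simpa [Submodule.vadd_def, AddSubgroup.vadd_def, add_comm] using hn
  · rintro ⟨_, m, rfl⟩ hm
    have : m = n := hu m (by simpa [AddSubgroup.vadd_def, add_comm] using hm.1)
    subst this; rfl

theorem isAddFundamentalDomain_minus :
    IsAddFundamentalDomain cylLattice ((Set.univ : Set ℝ) ×ˢ Set.Ico (0 : ℝ) 1) := by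
  refine IsAddFundamentalDomain.mk' (MeasurableSet.univ.prod measurableSet_Ico).nullMeasurableSet
    fun x => ?_
  obtain ⟨n, hn, hu⟩ := existsUnique_shift x.2
  refine ⟨⟨(-n) • (1, -1), -n, rfl⟩, ⟨trivial, ?_⟩, ?_⟩
  · simpa [AddSubgroup.vadd_def, add_comm] using hn
  · rintro ⟨_, m, rfl⟩ hm
    have : -m = n := hu (-m) (by simpa [AddSubgroup.vadd_def, add_comm] using hm.2)
    subst this; simp

theorem cylIntegral_swap (F : Cyl → ℝ) : cylIntegral F
    = ∫ x in Set.Ico (0 : ℝ) 1 ×ˢ (Set.univ : Set ℝ), F ((x.swap : ℝ × ℝ) : Cyl) := by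
  have h1 : cylIntegral F = ∫ x in (Set.univ : Set ℝ) ×ˢ Set.Ico (0 : ℝ) 1, F (x : Cyl) := by
    refine isAddFundamentalDomain_plus.setIntegral_eq isAddFundamentalDomain_minus ?_
    rintro ⟨_, m, rfl⟩ x
    congr 1
    have : ((⟨m • (1, -1), m, rfl⟩ : cylLattice) +ᵥ x) = (x.1 + m, x.2 - m) := by
      ext <;> simp [AddSubgroup.vadd_def, add_comm, sub_eq_add_neg]
    exact (congrArg _ this).trans (mk_shift x m)
  rw [h1, Measure.volume_eq_prod]
  exact (setIntegral_prod_swap (Set.univ : Set ℝ) (Set.Ico (0 : ℝ) 1) (fun x => F (x : Cyl))).symm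

theorem integrableOn_strip (f : CcCyl) {φ : ℝ × ℝ → ℝ} (hφ : Continuous φ) :
    IntegrableOn (fun x : ℝ × ℝ => f.1 (x : Cyl) * φ x)
      (Set.Ico (0 : ℝ) 1 ×ˢ (Set.univ : Set ℝ)) := by
  obtain ⟨R, hR⟩ := f.exists_bound
  have hc : Continuous (fun x : ℝ × ℝ => f.1 (x : Cyl) * φ x) := f.continuous_mk.mul hφ
  have h1 : IntegrableOn (fun x : ℝ × ℝ => f.1 (x : Cyl) * φ x)
      (Set.Icc (0 : ℝ) 1 ×ˢ Set.Icc (-R - 1) R) :=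
    hc.continuousOn.integrableOn_compact (isCompact_Icc.prod isCompact_Icc)
  refine h1.of_forall_sdiff_eq_zero (measurableSet_Ico.prod MeasurableSet.univ) fun x hx => ?_
  rw [hR, zero_mul]
  by_contra h
  obtain ⟨h2, h3⟩ := abs_le.1 (not_lt.1 h)
  have h4 := hx.1.1
  exact hx.2 ⟨⟨h4.1, h4.2.le⟩, by linarith [h4.1, h4.2], by linarith [h4.1, h4.2]⟩

theorem cylIntegral_plus (f : CcCyl) (φ : SmoothCircle) :
    ∫ x in Set.Ico (0 : ℝ) 1 ×ˢ (Set.univ : Set ℝ), f.1 (x : Cyl) * φ.1 (x.1 : UnitAddCircle)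
      = ∫ u in (0 : ℝ)..1, (CcCyl.fiberPlus f).1 (u : UnitAddCircle) * φ.1 (u : UnitAddCircle) := by
  have hi := integrableOn_strip f (φ := fun x => φ.1 (x.1 : UnitAddCircle))
    (φ.smooth.continuous.comp continuous_fst)
  rw [Measure.volume_eq_prod] at hi ⊢
  rw [setIntegral_prod _ hi, intervalIntegral.integral_of_le zero_le_one,
    integral_Ico_eq_integral_Ioc]
  refine integral_congr_ae (Filter.Eventually.of_forall fun u => ?_)
  simp only [Measure.restrict_univ, CcCyl.fiberPlus_coe]
  exact integral_mul_const _ _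

theorem cylIntegral_minus (f : CcCyl) (φ : SmoothCircle) :
    ∫ x in Set.Ico (0 : ℝ) 1 ×ˢ (Set.univ : Set ℝ), f.1 (x : Cyl) * φ.1 (x.2 : UnitAddCircle)
      = ∫ u in (0 : ℝ)..1, (CcCyl.fiberMinus f).1 (u : UnitAddCircle) * φ.1 (u : UnitAddCircle) := by
  rw [CcCyl.fiberMinus_eq, ← cylIntegral_plus]
  exact cylIntegral_swap (lift (fun x : ℝ × ℝ => f.1 (x : Cyl) * φ.1 (x.2 : UnitAddCircle))
    (fun x n => by
      rw [mk_shift]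
      congr 1
      simpa using φ.periodic.sub_zsmul_eq (x := x.2) n))

end Cyl

open MeasureTheory in
/-- The pairing of one-forms in terms of fiber integrals. -/
theorem tauForm_eq (α β : OneForm) : tauForm α β
    = SmoothCircle.poisson.form (CcCyl.fiberMinus α.1) (CcCyl.fiberMinus β.1)
      + SmoothCircle.poisson.form (CcCyl.fiberPlus α.2) (CcCyl.fiberPlus β.2) := by
  have hd : dForm α = CcCyl.dMinus α.1 - CcCyl.dPlus α.2 := rfl
  set φ := CcCyl.fiberMinus β.1 with hφ
  set ψ := CcCyl.fiberPlus β.2 with hψ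
  have hm : Continuous fun x : ℝ × ℝ => φ.1 (x.2 : UnitAddCircle) :=
    φ.smooth.continuous.comp continuous_snd
  have hp : Continuous fun x : ℝ × ℝ => ψ.1 (x.1 : UnitAddCircle) :=
    ψ.smooth.continuous.comp continuous_fst
  have h1 := Cyl.integrableOn_strip (dForm α) hm
  have h2 := Cyl.integrableOn_strip (dForm α) hp
  have key : tauForm α β = (1 / 2) * ((∫ u in (0 : ℝ)..1,
        (CcCyl.fiberMinus (dForm α)).1 (u : UnitAddCircle) * φ.1 (u : UnitAddCircle))
      - ∫ u in (0 : ℝ)..1,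
        (CcCyl.fiberPlus (dForm α)).1 (u : UnitAddCircle) * ψ.1 (u : UnitAddCircle)) := by
    rw [← Cyl.cylIntegral_minus, ← Cyl.cylIntegral_plus, ← integral_sub h1 h2,
      ← integral_const_mul, tauForm, cylIntegral]
    refine integral_congr_ae (Filter.Eventually.of_forall fun x => ?_)
    simp only
    rw [CcCyl.causalProp_dForm]
    ring
  have e1 : ∫ u in (0 : ℝ)..1,
      (CcCyl.fiberMinus (dForm α)).1 (u : UnitAddCircle) * φ.1 (u : UnitAddCircle)
      = 2 * SmoothCircle.poisson.form (CcCyl.fiberMinus α.1) φ := by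
    rw [SmoothCircle.poisson.neg, SmoothCircle.poisson_apply, hd, map_sub,
      CcCyl.fiberMinus_dPlus, sub_zero]
    simp only [CcCyl.fiberMinus_dMinus, mul_comm (φ.1 _)]
    ring
  have e2 : ∫ u in (0 : ℝ)..1,
      (CcCyl.fiberPlus (dForm α)).1 (u : UnitAddCircle) * ψ.1 (u : UnitAddCircle)
      = - (2 * SmoothCircle.poisson.form (CcCyl.fiberPlus α.2) ψ) := by
    rw [SmoothCircle.poisson.neg, SmoothCircle.poisson_apply, hd, map_sub,
      CcCyl.fiberPlus_dMinus, zero_sub]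
    simp only [Submodule.coe_neg, Pi.neg_apply, CcCyl.fiberPlus_dPlus, mul_comm (ψ.1 _),
      neg_mul, intervalIntegral.integral_neg]
    ring
  rw [key, e1, e2]
  ring

/-- The pairing of one-forms as a bilinear form. -/
def tauBilin : OneForm →ₗ[ℝ] OneForm →ₗ[ℝ] ℝ :=
  LinearMap.mk₂ ℝ tauForm
    (fun α α' β => by
      simp only [tauForm_eq, Prod.fst_add, Prod.snd_add, map_add, LinearMap.add_apply]
      ring)
    (fun c α β => by
      simp only [tauForm_eq, Prod.smul_fst, Prod.smul_snd, map_smul, LinearMap.smul_apply,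
        smul_eq_mul]
      ring)
    (fun α β β' => by
      simp only [tauForm_eq, Prod.fst_add, Prod.snd_add, map_add]
      ring)
    (fun c α β => by
      simp only [tauForm_eq, Prod.smul_fst, Prod.smul_snd, map_smul, smul_eq_mul]
      ring)

theorem tauForm_neg (α β : OneForm) : tauForm β α = - tauForm α β := by
  rw [tauForm_eq, tauForm_eq, SmoothCircle.poisson.neg (CcCyl.fiberMinus α.1),
    SmoothCircle.poisson.neg (CcCyl.fiberPlus α.2)]
  ring

theorem trivialForms_fiber {α : OneForm} (h : α ∈ trivialForms) :
    CcCyl.fiberMinus α.1 = 0 ∧ CcCyl.fiberPlus α.2 = 0 := by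
  obtain ⟨_, ⟨f, rfl⟩, _, ⟨g, rfl⟩, rfl⟩ := Submodule.mem_sup.1 h
  constructor
  · change CcCyl.fiberMinus (CcCyl.dPlus f + CcCyl.dPlus g) = 0
    rw [← map_add, CcCyl.fiberMinus_dPlus]
  · change CcCyl.fiberPlus (CcCyl.dMinus f + -CcCyl.dMinus g) = 0
    rw [map_add, map_neg, CcCyl.fiberPlus_dMinus, CcCyl.fiberPlus_dMinus, neg_zero, add_zero]

theorem tauForm_trivial {α : OneForm} (h : α ∈ trivialForms) (β : OneForm) :
    tauForm α β = 0 := by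
  obtain ⟨h1, h2⟩ := trivialForms_fiber h
  rw [tauForm_eq, h1, h2]
  simp

/-- The Poisson structure `τ([α], [β]) = ∫ dα G(dβ)` on the linear observables. -/
def tauCyl : PoissonForm LinObs where
  form := trivialForms.liftQ
    (LinearMap.flip (trivialForms.liftQ tauBilin.flip fun β hβ =>
      LinearMap.ext fun α => (tauForm_neg β α).trans (by rw [tauForm_trivial hβ, neg_zero]; rfl)))
    (fun α hα => LinearMap.ext fun b => by
      induction b using Submodule.Quotient.induction_on with
      | H β => exact tauForm_trivial hα β)
  alt v := by
    induction v using Submodule.Quotient.induction_on with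
    | H α =>
      change tauForm α α = 0
      rw [tauForm_eq, SmoothCircle.poisson.alt, SmoothCircle.poisson.alt, add_zero]

theorem tauCyl_mk (α β : OneForm) :
    tauCyl.form (trivialForms.mkQ α) (trivialForms.mkQ β) = tauForm α β := rfl

/-! ### Diffeomorphisms of the circle and conformal automorphisms of the cylinder -/

/-- The lifts to `ℝ` of orientation preserving diffeomorphisms of the circle `ℝ/ℤ`, as a subgroup
of the permutations of `ℝ`. -/
def liftDiff : Subgroup (Equiv.Perm ℝ) where
  carrier := {G | ContDiff ℝ ∞ G ∧ (∀ x, 0 < deriv G x) ∧ ∀ x, G (x + 1) = G x + 1}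
  one_mem' := ⟨contDiff_id, fun x => by
    have : deriv (⇑(1 : Equiv.Perm ℝ)) x = 1 := (hasDerivAt_id x).deriv
    rw [this]; exact one_pos, fun _ => rfl⟩
  mul_mem' {G H} hG hH := by
    refine ⟨hG.1.comp hH.1, fun x => ?_, fun x => ?_⟩
    · have : deriv (⇑(G * H)) x = deriv G (H x) * deriv H x :=
        ((hG.1.differentiable (by simp) (H x)).hasDerivAt.comp x
          (hH.1.differentiable (by simp) x).hasDerivAt).deriv
      rw [this]
      exact mul_pos (hG.2.1 _) (hH.2.1 _)
    · simp only [Equiv.Perm.coe_mul, Function.comp_apply, hH.2.2, hG.2.2]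
  inv_mem' {G} hG := by
    have hmono : StrictMono G := strictMono_of_deriv_pos hG.2.1
    let e : ℝ ≃ₜ ℝ := (StrictMono.orderIsoOfSurjective G hmono G.surjective).toHomeomorph
    have he : ⇑e.symm = ⇑(G⁻¹) := by
      funext x
      apply G.injective
      exact (e.apply_symm_apply x).trans (G.apply_symm_apply x).symm
    have hd : ∀ x, HasDerivAt G (deriv G x) x :=
      fun x => (hG.1.differentiable (by simp) x).hasDerivAt
    have hs : ContDiff ℝ ∞ (⇑(G⁻¹)) := by
      rw [← he]
      exact e.contDiff_symm_deriv (fun x => (hG.2.1 x).ne') hd hG.1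
    refine ⟨hs, fun x => ?_, fun x => ?_⟩
    · have h1 : HasDerivAt (⇑(G⁻¹)) (deriv (⇑(G⁻¹)) x) x :=
        (hs.differentiable (by simp) x).hasDerivAt
      have h2 := (hd (G⁻¹ x)).comp x h1
      have h3 : (⇑G ∘ ⇑(G⁻¹)) = id := by funext y; simp
      rw [h3] at h2
      have h4 := h2.unique (hasDerivAt_id x)
      by_contra h
      have := mul_nonpos_of_nonneg_of_nonpos (hG.2.1 (G⁻¹ x)).le (not_lt.1 h)
      linarith
    · apply G.injective
      rw [hG.2.2]
      simp

/-- The group of lifts to `ℝ` of orientation preserving diffeomorphisms of the circle `ℝ/ℤ`. -/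
abbrev LiftDiff : Type := liftDiff

namespace LiftDiff

theorem smooth (G : LiftDiff) : ContDiff ℝ ∞ G.1 := G.2.1

theorem deriv_pos (G : LiftDiff) (x : ℝ) : 0 < deriv G.1 x := G.2.2.1 x

theorem hasDerivAt (G : LiftDiff) (x : ℝ) : HasDerivAt G.1 (deriv G.1 x) x :=
  (G.smooth.differentiable (by simp) x).hasDerivAt

theorem map_add_int (G : LiftDiff) (x : ℝ) (n : ℤ) : G.1 (x + n) = G.1 x + n := by
  induction n using Int.induction_on with
  | zero => simp
  | succ n ih =>
    push_cast at ih ⊢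
    rw [← add_assoc, G.2.2.2, ih, add_assoc]
  | pred n ih =>
    have := G.2.2.2 (x + ((-(n : ℤ) - 1 : ℤ) : ℝ))
    push_cast at this ih ⊢
    rw [show x + (-(n : ℝ) - 1) + 1 = x + -(n : ℝ) by ring, ih] at this
    linarith

theorem map_sub_int (G : LiftDiff) (x : ℝ) (n : ℤ) : G.1 (x - n) = G.1 x - n := by
  have := G.map_add_int x (-n)
  simpa [sub_eq_add_neg] using this

theorem deriv_add_int (G : LiftDiff) (x : ℝ) (n : ℤ) : deriv G.1 (x + n) = deriv G.1 x := by
  have h1 : (fun x : ℝ => G.1 (x + n)) = fun x => G.1 x + n := funext fun x => G.map_add_int x n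
  have h2 := congrArg (fun f => deriv f x) h1
  simpa [deriv_comp_add_const] using h2

theorem deriv_sub_int (G : LiftDiff) (x : ℝ) (n : ℤ) : deriv G.1 (x - n) = deriv G.1 x := by
  have := G.deriv_add_int x (-n)
  simpa [sub_eq_add_neg] using this

theorem deriv_mul (G H : LiftDiff) (x : ℝ) :
    deriv (G * H).1 x = deriv G.1 (H.1 x) * deriv H.1 x :=
  ((G.hasDerivAt (H.1 x)).comp x (H.hasDerivAt x)).deriv

/-- The self-map of the circle with lift `G`. -/
def circleFun (G : LiftDiff) : UnitAddCircle → UnitAddCircle :=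
  Function.Periodic.lift (f := fun x : ℝ => ((G.1 x : ℝ) : UnitAddCircle)) (c := 1) fun x => by
    simp only [G.2.2.2, AddCircle.coe_add_period]

/-- The action of lifts on the circle. -/
def toCircle : LiftDiff →* Equiv.Perm UnitAddCircle where
  toFun G :=
    { toFun := circleFun G
      invFun := circleFun G⁻¹
      left_inv := fun p => by
        induction p using QuotientAddGroup.induction_on with
        | H x => exact congrArg _ (G.1.symm_apply_apply x)
      right_inv := fun p => by
        induction p using QuotientAddGroup.induction_on with
        | H x => exact congrArg _ (G.1.apply_symm_apply x) }
  map_one' := by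
    ext p
    induction p using QuotientAddGroup.induction_on with
    | H x => rfl
  map_mul' G H := by
    ext p
    induction p using QuotientAddGroup.induction_on with
    | H x => rfl

theorem toCircle_coe (G : LiftDiff) (x : ℝ) :
    toCircle G (x : UnitAddCircle) = ((G.1 x : ℝ) : UnitAddCircle) := rfl

/-- The self-map `[(x⁺, x⁻)] ↦ [(G⁺ x⁺, G⁻ x⁻)]` of the cylinder. -/
def cylFun (G : LiftDiff × LiftDiff) : Cyl → Cyl :=
  Cyl.lift (fun x => ((G.1.1 x.1, G.2.1 x.2) : ℝ × ℝ)) fun x n => by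
    simp only [map_add_int, map_sub_int]
    exact Cyl.mk_shift (G.1.1 x.1, G.2.1 x.2) n

/-- The action of pairs of lifts on the cylinder. -/
def toCyl : LiftDiff × LiftDiff →* Equiv.Perm Cyl where
  toFun G :=
    { toFun := cylFun G
      invFun := cylFun G⁻¹
      left_inv := fun p => by
        induction p using QuotientAddGroup.induction_on with
        | H x =>
          exact congrArg _ (Prod.ext (G.1.1.symm_apply_apply x.1) (G.2.1.symm_apply_apply x.2))
      right_inv := fun p => by
        induction p using QuotientAddGroup.induction_on with
        | H x =>
          exact congrArg _ (Prod.ext (G.1.1.apply_symm_apply x.1) (G.2.1.apply_symm_apply x.2)) }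
  map_one' := by
    ext p
    induction p using QuotientAddGroup.induction_on with
    | H x => rfl
  map_mul' G H := by
    ext p
    induction p using QuotientAddGroup.induction_on with
    | H x => rfl

theorem toCyl_coe (G : LiftDiff × LiftDiff) (x : ℝ × ℝ) :
    toCyl G (x : Cyl) = ((G.1.1 x.1, G.2.1 x.2) : ℝ × ℝ) := rfl

end LiftDiff

/-- The group `Diff⁺(𝕋)` of orientation preserving diffeomorphisms of the circle, the
endomorphisms of `𝕋` in the category of oriented one-manifolds and embeddings. -/
def DiffCircle : Subgroup (Equiv.Perm UnitAddCircle) := LiftDiff.toCircle.range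

/-- The endomorphisms of the flat cylinder in the category of oriented and time-oriented conformal
Lorentzian surfaces (causally convex conformal embeddings): the maps
`[(x⁺, x⁻)] ↦ [(G⁺ x⁺, G⁻ x⁻)]` for lifts `G⁺`, `G⁻` of elements of `Diff⁺(𝕋)`. -/
def CylMor : Subgroup (Equiv.Perm Cyl) := LiftDiff.toCyl.range

/-- The two chiralities. -/
inductive Chirality
  | plus
  | minus

namespace Chirality

/-- The sign of a chirality. -/
def sign : Chirality → ℝ
  | plus => 1
  | minus => -1

/-- The opposite chirality. -/
def opp : Chirality → Chirality
  | plus => minus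
  | minus => plus

/-- The component of a pair belonging to a chirality. -/
def proj {X : Type*} : Chirality → X × X → X
  | plus, x => x.1
  | minus, x => x.2

end Chirality

theorem LiftDiff.eq_shift_of_toCyl_eq {G H : LiftDiff × LiftDiff}
    (h : LiftDiff.toCyl G = LiftDiff.toCyl H) :
    ∃ n : ℤ, (∀ x, H.1.1 x = G.1.1 x + n) ∧ ∀ x, H.2.1 x = G.2.1 x - n := by
  have h1 : ∀ x : ℝ × ℝ, ∃ n : ℤ, H.1.1 x.1 = G.1.1 x.1 + n ∧ H.2.1 x.2 = G.2.1 x.2 - n := fun x =>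
    Cyl.mk_eq_mk.1 (congrArg (fun e : Equiv.Perm Cyl => e (x : Cyl)) h)
  obtain ⟨n, hn1, hn2⟩ := h1 (0, 0)
  refine ⟨n, fun x => ?_, fun x => ?_⟩
  · obtain ⟨m, hm1, hm2⟩ := h1 (x, 0)
    have : (m : ℝ) = n := by linarith
    rw [hm1, this]
  · obtain ⟨m, hm1, hm2⟩ := h1 (0, x)
    have : (m : ℝ) = n := by linarith
    rw [hm2, this]

theorem LiftDiff.toCircle_proj_eq (s : Chirality) {G H : LiftDiff × LiftDiff}
    (h : LiftDiff.toCyl G = LiftDiff.toCyl H) :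
    LiftDiff.toCircle (s.proj G) = LiftDiff.toCircle (s.proj H) := by
  obtain ⟨n, h1, h2⟩ := LiftDiff.eq_shift_of_toCyl_eq h
  ext p
  induction p using QuotientAddGroup.induction_on with
  | H x =>
    cases s
    · change ((G.1.1 x : ℝ) : UnitAddCircle) = ((H.1.1 x : ℝ) : UnitAddCircle)
      rw [h1]
      simp
    · change ((G.2.1 x : ℝ) : UnitAddCircle) = ((H.2.1 x : ℝ) : UnitAddCircle)
      refine Eq.symm ?_
      rw [h2]
      simp

/-- The functor `π_±` on endomorphisms of the cylinder, `[G⁺, G⁻] ↦ [G^±]`; the chosen lifts of an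
endomorphism do not matter. -/
def projMor (s : Chirality) : CylMor →* DiffCircle where
  toFun f := ⟨LiftDiff.toCircle (s.proj f.2.choose), _, rfl⟩
  map_one' := Subtype.ext <| by
    have h : LiftDiff.toCyl (1 : CylMor).2.choose = LiftDiff.toCyl 1 :=
      (1 : CylMor).2.choose_spec.trans (map_one _).symm
    refine (LiftDiff.toCircle_proj_eq s h).trans ?_
    cases s <;> exact map_one LiftDiff.toCircle
  map_mul' f g := Subtype.ext <| by
    have h : LiftDiff.toCyl (f * g).2.choose = LiftDiff.toCyl (f.2.choose * g.2.choose) := by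
      rw [(f * g).2.choose_spec, map_mul, f.2.choose_spec, g.2.choose_spec]
      rfl
    refine (LiftDiff.toCircle_proj_eq s h).trans ?_
    cases s <;> exact map_mul LiftDiff.toCircle _ _

theorem projMor_toCyl (s : Chirality) (G : LiftDiff × LiftDiff) :
    (projMor s ⟨LiftDiff.toCyl G, G, rfl⟩).1 = LiftDiff.toCircle (s.proj G) :=
  LiftDiff.toCircle_proj_eq s
    (Exists.choose_spec (⟨G, rfl⟩ : LiftDiff.toCyl G ∈ LiftDiff.toCyl.range))

/-! ### Push-forward of forms and functoriality of the observables -/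

namespace LiftDiff

open MeasureTheory

theorem continuous_toCyl (H : LiftDiff × LiftDiff) : Continuous (toCyl H) := by
  refine continuous_coinduced_dom.2 ?_
  have : Continuous fun x : ℝ × ℝ => (H.1.1 x.1, H.2.1 x.2) :=
    (H.1.smooth.continuous.comp continuous_fst).prodMk (H.2.smooth.continuous.comp continuous_snd)
  exact continuous_quot_mk.comp this

/-- The homeomorphism of the cylinder given by a pair of lifts. -/
def homeo (H : LiftDiff × LiftDiff) : Cyl ≃ₜ Cyl where
  toEquiv := toCyl H
  continuous_toFun := continuous_toCyl H
  continuous_invFun := by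
    have h := continuous_toCyl H⁻¹
    rw [map_inv] at h
    exact h

theorem contDiff_pair (H : LiftDiff × LiftDiff) :
    ContDiff ℝ ∞ fun x : ℝ × ℝ => (H.1.1 x.1, H.2.1 x.2) :=
  (H.1.smooth.comp contDiff_fst).prodMk (H.2.smooth.comp contDiff_snd)

theorem contDiff_deriv (H : LiftDiff) : ContDiff ℝ ∞ (deriv H.1) :=
  (contDiff_infty_iff_deriv.1 H.smooth).2

/-- Pullback of test functions along the automorphism of the cylinder with lifts `H`. -/
def pullFun (H : LiftDiff × LiftDiff) (a : CcCyl) : CcCyl :=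
  ⟨fun p => a.1 (toCyl H p), a.smooth.comp (contDiff_pair H),
    a.2.2.comp_homeomorph (homeo H)⟩

/-- Pullback of the coefficient of `dx^±`, where `(H^±)' (x^±)` is the
coefficient of the pullback of `dx^±`. -/
def pullCoeff (s : Chirality) (H : LiftDiff × LiftDiff) : CcCyl →ₗ[ℝ] CcCyl where
  toFun a := ⟨fun p => a.1 (toCyl H p) *
      Cyl.lift (fun x => deriv (s.proj H).1 (s.proj x)) (fun x n => by
        cases s
        · exact deriv_add_int _ _ _
        · exact deriv_sub_int _ _ _) p, by
    refine ⟨(pullFun H a).smooth.mul ?_, (pullFun H a).2.2.mul_right⟩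
    cases s
    · exact (contDiff_deriv H.1).comp contDiff_fst
    · exact (contDiff_deriv H.2).comp contDiff_snd⟩
  map_add' a b := by ext p; exact add_mul _ _ _
  map_smul' c a := by ext p; exact mul_assoc _ _ _

theorem pullCoeff_plus (H : LiftDiff × LiftDiff) (a : CcCyl) (u v : ℝ) :
    (pullCoeff .plus H a).1 ((u, v) : ℝ × ℝ)
      = a.1 ((H.1.1 u, H.2.1 v) : ℝ × ℝ) * deriv H.1.1 u := rfl

theorem pullCoeff_minus (H : LiftDiff × LiftDiff) (a : CcCyl) (u v : ℝ) :
    (pullCoeff .minus H a).1 ((u, v) : ℝ × ℝ)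
      = a.1 ((H.1.1 u, H.2.1 v) : ℝ × ℝ) * deriv H.2.1 v := rfl

/-- Push-forward of one-forms, that is pullback along the inverse, under the automorphism
`[(x⁺, x⁻)] ↦ [(G⁺ x⁺, G⁻ x⁻)]` of the cylinder. -/
def pushForm (G : LiftDiff × LiftDiff) : OneForm →ₗ[ℝ] OneForm :=
  LinearMap.prodMap (pullCoeff .plus G⁻¹) (pullCoeff .minus G⁻¹)

theorem pullCoeff_congr (s : Chirality) {G H : LiftDiff × LiftDiff} (h : toCyl G = toCyl H) :
    pullCoeff s G = pullCoeff s H := by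
  obtain ⟨n, h1, h2⟩ := eq_shift_of_toCyl_eq h
  ext a p
  induction p using QuotientAddGroup.induction_on with
  | H x =>
    change a.1 (toCyl G x) * deriv (s.proj G).1 (s.proj x)
      = a.1 (toCyl H x) * deriv (s.proj H).1 (s.proj x)
    rw [h]
    congr 1
    cases s
    · have : H.1.1 = fun x => G.1.1 x + n := funext h1
      change deriv G.1.1 x.1 = deriv H.1.1 x.1
      have h3 := congrArg (fun f => deriv f x.1) this
      simpa using h3.symm
    · have : H.2.1 = fun x => G.2.1 x - n := funext h2
      change deriv G.2.1 x.2 = deriv H.2.1 x.2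
      have h3 := congrArg (fun f => deriv f x.2) this
      simpa using h3.symm

/-- The push-forward only depends on the automorphism of the cylinder. -/
theorem pushForm_congr {G H : LiftDiff × LiftDiff} (h : toCyl G = toCyl H) :
    pushForm G = pushForm H := by
  have h' : toCyl G⁻¹ = toCyl H⁻¹ := by rw [map_inv, map_inv, h]
  rw [pushForm, pushForm, pullCoeff_congr .plus h', pullCoeff_congr .minus h']

theorem pullCoeff_one (s : Chirality) : pullCoeff s 1 = LinearMap.id := by
  ext a p
  induction p using QuotientAddGroup.induction_on with
  | H x =>
    have h1 : ∀ x : ℝ, deriv (1 : LiftDiff).1 x = 1 := fun x => (hasDerivAt_id x).deriv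
    cases s
    · change a.1 (x : Cyl) * deriv (1 : LiftDiff).1 x.1 = a.1 (x : Cyl)
      rw [h1, mul_one]
    · change a.1 (x : Cyl) * deriv (1 : LiftDiff).1 x.2 = a.1 (x : Cyl)
      rw [h1, mul_one]

theorem pullCoeff_mul (s : Chirality) (G H : LiftDiff × LiftDiff) :
    pullCoeff s (G * H) = pullCoeff s H ∘ₗ pullCoeff s G := by
  ext a p
  induction p using QuotientAddGroup.induction_on with
  | H x =>
    cases s
    · change a.1 (toCyl G (toCyl H x)) * deriv (G.1 * H.1).1 x.1
        = a.1 (toCyl G (toCyl H x)) * deriv G.1.1 (H.1.1 x.1) * deriv H.1.1 x.1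
      rw [deriv_mul, mul_assoc]
    · change a.1 (toCyl G (toCyl H x)) * deriv (G.2 * H.2).1 x.2
        = a.1 (toCyl G (toCyl H x)) * deriv G.2.1 (H.2.1 x.2) * deriv H.2.1 x.2
      rw [deriv_mul, mul_assoc]

theorem pushForm_one : pushForm 1 = LinearMap.id := by
  rw [pushForm, inv_one, pullCoeff_one, pullCoeff_one]
  rfl

theorem pushForm_mul (G H : LiftDiff × LiftDiff) :
    pushForm (G * H) = pushForm G ∘ₗ pushForm H := by
  rw [pushForm, mul_inv_rev, pullCoeff_mul, pullCoeff_mul]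
  rfl

theorem dPlus_pullFun (H : LiftDiff × LiftDiff) (f : CcCyl) :
    CcCyl.dPlus (pullFun H f) = pullCoeff .plus H (CcCyl.dPlus f) := by
  ext p
  induction p using QuotientAddGroup.induction_on with
  | H x =>
    obtain ⟨u, v⟩ := x
    exact (CcCyl.hasDerivAt_plus (pullFun H f) u v).unique
      ((CcCyl.hasDerivAt_plus f (H.1.1 u) (H.2.1 v)).comp u (H.1.hasDerivAt u))

theorem dMinus_pullFun (H : LiftDiff × LiftDiff) (f : CcCyl) :
    CcCyl.dMinus (pullFun H f) = pullCoeff .minus H (CcCyl.dMinus f) := by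
  ext p
  induction p using QuotientAddGroup.induction_on with
  | H x =>
    obtain ⟨u, v⟩ := x
    exact (CcCyl.hasDerivAt_minus (pullFun H f) u v).unique
      ((CcCyl.hasDerivAt_minus f (H.1.1 u) (H.2.1 v)).comp v (H.2.hasDerivAt v))

theorem pushForm_dFun (G : LiftDiff × LiftDiff) (f : CcCyl) :
    pushForm G (dFun f) = dFun (pullFun G⁻¹ f) :=
  (Prod.ext (dPlus_pullFun G⁻¹ f) (dMinus_pullFun G⁻¹ f)).symm

theorem pushForm_hodge (G : LiftDiff × LiftDiff) (α : OneForm) :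
    pushForm G (hodge α) = hodge (pushForm G α) :=
  Prod.ext rfl (map_neg (pullCoeff .minus G⁻¹) α.2)

theorem pushForm_trivialForms (G : LiftDiff × LiftDiff) :
    trivialForms ≤ trivialForms.comap (pushForm G) := by
  refine sup_le ?_ ?_
  · rintro _ ⟨f, rfl⟩
    exact Submodule.mem_sup_left ⟨pullFun G⁻¹ f, (pushForm_dFun G f).symm⟩
  · rintro _ ⟨f, rfl⟩
    refine Submodule.mem_sup_right ⟨pullFun G⁻¹ f, ?_⟩
    rw [LinearMap.comp_apply, LinearMap.comp_apply, pushForm_hodge, pushForm_dFun]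

/-- Substitution formula on the line. -/
theorem integral_comp (H : LiftDiff) (g : ℝ → ℝ) :
    ∫ x, g (H.1 x) * deriv H.1 x = ∫ x, g x := by
  have := integral_image_eq_integral_abs_deriv_smul (s := Set.univ) (f := H.1)
    (f' := deriv H.1) MeasurableSet.univ (fun x _ => (H.hasDerivAt x).hasDerivWithinAt)
    H.1.injective.injOn g
  rw [Set.image_univ, H.1.surjective.range_eq, Measure.restrict_univ] at this
  rw [this]
  refine integral_congr_ae (Filter.Eventually.of_forall fun x => ?_)
  simp only [abs_of_pos (H.deriv_pos x), smul_eq_mul, mul_comm]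

/-- Composition of functions on the circle with the diffeomorphism with lift `H`. -/
def pullCircle (H : LiftDiff) (φ : SmoothCircle) : SmoothCircle :=
  ⟨fun p => φ.1 (toCircle H p), φ.smooth.comp H.smooth⟩

theorem fiberMinus_pullCoeff (H : LiftDiff × LiftDiff) (a : CcCyl) :
    CcCyl.fiberMinus (pullCoeff .plus H a) = pullCircle H.2 (CcCyl.fiberMinus a) := by
  ext p
  induction p using QuotientAddGroup.induction_on with
  | H v => exact integral_comp H.1 (fun u => a.1 ((u, H.2.1 v) : ℝ × ℝ))

theorem fiberPlus_pullCoeff (H : LiftDiff × LiftDiff) (a : CcCyl) :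
    CcCyl.fiberPlus (pullCoeff .minus H a) = pullCircle H.1 (CcCyl.fiberPlus a) := by
  ext p
  induction p using QuotientAddGroup.induction_on with
  | H u => exact integral_comp H.2 (fun v => a.1 ((H.1.1 u, v) : ℝ × ℝ))

theorem poisson_pullCircle (H : LiftDiff) (φ ψ : SmoothCircle) :
    SmoothCircle.poisson.form (pullCircle H φ) (pullCircle H ψ) = SmoothCircle.poisson.form φ ψ := by
  rw [SmoothCircle.poisson_apply, SmoothCircle.poisson_apply]
  congr 1
  let g : ℝ → ℝ := fun x => φ.1 (x : UnitAddCircle) * deriv (fun y : ℝ => ψ.1 (y : UnitAddCircle)) x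
  have hg : Continuous g := φ.smooth.continuous.mul ψ.continuous_deriv
  have hper : Function.Periodic g 1 := by
    intro x
    have hd : deriv (fun y : ℝ => ψ.1 (y : UnitAddCircle)) (x + 1)
        = deriv (fun y : ℝ => ψ.1 (y : UnitAddCircle)) x := by
      rw [← deriv_comp_add_const]
      congr 1
      funext y
      exact ψ.periodic y
    simp only [g, hd]
    rw [show φ.1 ((x + 1 : ℝ) : UnitAddCircle) = φ.1 (x : UnitAddCircle) from φ.periodic x]
  have h1 : ∀ x : ℝ, (pullCircle H φ).1 (x : UnitAddCircle)
      * deriv (fun y : ℝ => (pullCircle H ψ).1 (y : UnitAddCircle)) x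
      = deriv H.1 x • (g ∘ H.1) x := by
    intro x
    have : deriv (fun y : ℝ => (pullCircle H ψ).1 (y : UnitAddCircle)) x
        = deriv (fun y : ℝ => ψ.1 (y : UnitAddCircle)) (H.1 x) * deriv H.1 x :=
      ((ψ.hasDerivAt (H.1 x)).comp x (H.hasDerivAt x)).deriv
    rw [this]
    change φ.1 ((H.1 x : ℝ) : UnitAddCircle) * _ = _ * (φ.1 ((H.1 x : ℝ) : UnitAddCircle) * _)
    ring
  simp only [h1]
  rw [intervalIntegral.integral_deriv_smul_comp' (fun x _ => H.hasDerivAt x)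
    (contDiff_deriv H).continuous.continuousOn hg.continuousOn]
  have h2 : H.1 1 = H.1 0 + 1 := by simpa using H.2.2.2 0
  rw [h2, hper.intervalIntegral_add_eq (H.1 0) 0, zero_add]

theorem tauForm_pushForm (G : LiftDiff × LiftDiff) (α β : OneForm) :
    tauForm (pushForm G α) (pushForm G β) = tauForm α β := by
  rw [tauForm_eq, tauForm_eq]
  change SmoothCircle.poisson.form (CcCyl.fiberMinus (pullCoeff .plus G⁻¹ α.1))
      (CcCyl.fiberMinus (pullCoeff .plus G⁻¹ β.1))
    + SmoothCircle.poisson.form (CcCyl.fiberPlus (pullCoeff .minus G⁻¹ α.2))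
      (CcCyl.fiberPlus (pullCoeff .minus G⁻¹ β.2)) = _
  simp only [fiberMinus_pullCoeff, fiberPlus_pullCoeff, poisson_pullCircle]

end LiftDiff

/-- The push-forward of linear observables under an endomorphism of the cylinder. -/
def pushObs (f : CylMor) : LinObs →ₗ[ℝ] LinObs :=
  trivialForms.mapQ trivialForms (LiftDiff.pushForm f.2.choose)
    (LiftDiff.pushForm_trivialForms f.2.choose)

/-- The push-forward may be computed with any lift. -/
theorem pushObs_toCyl (G : LiftDiff × LiftDiff) (α : OneForm) :
    pushObs ⟨LiftDiff.toCyl G, G, rfl⟩ (trivialForms.mkQ α)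
      = trivialForms.mkQ (LiftDiff.pushForm G α) := by
  have h := LiftDiff.pushForm_congr
    (Exists.choose_spec (⟨G, rfl⟩ : LiftDiff.toCyl G ∈ LiftDiff.toCyl.range))
  exact congrArg (fun L : OneForm →ₗ[ℝ] OneForm => trivialForms.mkQ (L α)) h

theorem pushObs_tau (f : CylMor) (v w : LinObs) :
    tauCyl.form (pushObs f v) (pushObs f w) = tauCyl.form v w := by
  induction v using Submodule.Quotient.induction_on with
  | H α =>
    induction w using Submodule.Quotient.induction_on with
    | H β => exact LiftDiff.tauForm_pushForm _ α β

theorem pushObs_one : pushObs 1 = LinearMap.id := by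
  refine LinearMap.ext fun v => ?_
  induction v using Submodule.Quotient.induction_on with
  | H α =>
    have h : LiftDiff.toCyl (1 : CylMor).2.choose = LiftDiff.toCyl 1 :=
      (1 : CylMor).2.choose_spec.trans (map_one _).symm
    have h2 := (LiftDiff.pushForm_congr h).trans LiftDiff.pushForm_one
    exact congrArg (fun L : OneForm →ₗ[ℝ] OneForm => trivialForms.mkQ (L α)) h2

theorem pushObs_mul (f g : CylMor) : pushObs (f * g) = pushObs f ∘ₗ pushObs g := by
  refine LinearMap.ext fun v => ?_
  induction v using Submodule.Quotient.induction_on with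
  | H α =>
    have h : LiftDiff.toCyl (f * g).2.choose = LiftDiff.toCyl (f.2.choose * g.2.choose) := by
      rw [(f * g).2.choose_spec, map_mul, f.2.choose_spec, g.2.choose_spec]
      rfl
    have h2 := (LiftDiff.pushForm_congr h).trans (LiftDiff.pushForm_mul _ _)
    exact congrArg (fun L : OneForm →ₗ[ℝ] OneForm => trivialForms.mkQ (L α)) h2

/-- The algebra `𝔄(𝕄/ℤ) = CCR(𝔏(𝕄/ℤ), τ)` of the Abelian current on the flat cylinder. -/
abbrev CylAlg : Type := CCR tauCyl

/-- The functor `𝔄` on endomorphisms of the flat cylinder. -/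
def cylAction : CylMor →* (CylAlg →⋆ₐ[ℂ] CylAlg) where
  toFun f := CCR.map (pushObs f) (pushObs_tau f)
  map_one' := by
    have h : ∀ (g : LinObs →ₗ[ℝ] LinObs) (hg), g = LinearMap.id →
        CCR.map (τ := tauCyl) (σ := tauCyl) g hg = StarAlgHom.id ℂ CylAlg := by
      rintro g hg rfl
      exact CCR.map_id hg
    exact h _ _ pushObs_one
  map_mul' f g := by
    have h : ∀ (k : LinObs →ₗ[ℝ] LinObs) (hk), k = pushObs f ∘ₗ pushObs g →
        CCR.map (τ := tauCyl) (σ := tauCyl) k hk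
          = (CCR.map (pushObs f) (pushObs_tau f)).comp (CCR.map (pushObs g) (pushObs_tau g)) := by
      rintro k hk rfl
      exact CCR.map_comp _ _ _ _ hk
    exact h _ _ (pushObs_mul f g)

/-! ### The chiral components -/

/-- The chiral component `(π_±)_* 𝔄 (𝕋)`: the value at `𝕋` of the right Kan extension of `𝔄` along
`π_±`, given by the pointwise formula as the limit of `𝔄` over the comma category `𝕋 ↓ π_±`. Since
there are no embeddings of `𝕋` into `ℝ`, the objects of the comma category are the diffeomorphisms
`g : 𝕋 → 𝕋 = π_±(𝕄/ℤ)`, and its morphisms `g → h` are the endomorphisms `f` of `𝕄/ℤ` with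
`h = π_±(f) ∘ g`. The limit is the `*`-algebra of compatible families. -/
def chiralComponent (s : Chirality) : StarSubalgebra ℂ (DiffCircle → CylAlg) where
  carrier := {a | ∀ (f : CylMor) (g : DiffCircle), cylAction f (a g) = a (projMor s f * g)}
  mul_mem' ha hb f g := by simp only [Pi.mul_apply, map_mul, ha f g, hb f g]
  one_mem' f g := by simp only [Pi.one_apply, map_one]
  add_mem' ha hb f g := by simp only [Pi.add_apply, map_add, ha f g, hb f g]
  zero_mem' f g := by simp only [Pi.zero_apply, map_zero]
  algebraMap_mem' c f g := by
    simp only [Pi.algebraMap_apply]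
    exact AlgHomClass.commutes (cylAction f) c
  star_mem' ha f g := by simp only [Pi.star_apply, map_star, ha f g]

/-- The canonical map from the chiral component to `𝔄(𝕄/ℤ)`, the leg of the limit cone at the
identity of `𝕋` (the counit of the adjunction between pullback and right Kan extension). -/
def chiralComponent.toCylAlg (s : Chirality) : chiralComponent s →⋆ₐ[ℂ] CylAlg where
  toFun a := a.1 1
  map_one' := rfl
  map_mul' _ _ := rfl
  map_zero' := rfl
  map_add' _ _ := rfl
  commutes' _ := rfl
  map_star' _ := rfl

/-- The self-dual (`∗ α = α`) respectively anti-self-dual (`∗ α = - α`) compactly supported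
one-forms. -/
def dualForms (s : Chirality) : Submodule ℝ OneForm :=
  LinearMap.ker (hodge - s.sign • LinearMap.id)

/-- The projector `½ (id ± ∗)` on one-forms. -/
def dualProj (s : Chirality) : OneForm →ₗ[ℝ] OneForm :=
  (1 / 2 : ℝ) • (LinearMap.id + s.sign • hodge)

theorem hodge_trivialForms {α : OneForm} (h : α ∈ trivialForms) : hodge α ∈ trivialForms := by
  have hh : ∀ α : OneForm, hodge (hodge α) = α := fun α => Prod.ext rfl (neg_neg _)
  obtain ⟨_, ⟨f, rfl⟩, _, ⟨g, rfl⟩, rfl⟩ := Submodule.mem_sup.1 h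
  rw [map_add, LinearMap.comp_apply, hh]
  exact add_mem (Submodule.mem_sup_right ⟨f, rfl⟩) (Submodule.mem_sup_left ⟨g, rfl⟩)

theorem dualProj_trivialForms (s : Chirality) :
    trivialForms ≤ trivialForms.comap (dualProj s) := fun _ h =>
  trivialForms.smul_mem _ (trivialForms.add_mem h (trivialForms.smul_mem _ (hodge_trivialForms h)))

/-- The projection of the linear observables onto the (anti-)self-dual summand. -/
def obsProj (s : Chirality) : LinObs →ₗ[ℝ] LinObs :=
  trivialForms.mapQ trivialForms (dualProj s) (dualProj_trivialForms s)

/-- The (anti-)self-dual summand `Ω_c^{1,±} / d^± C_c^∞` of the linear observables, where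
`d^± = ½ (id ± ∗) d`, as the image of the (anti-)self-dual forms. -/
def dualObs (s : Chirality) : Submodule ℝ LinObs := (dualForms s).map trivialForms.mkQ

theorem mem_dualForms {s : Chirality} {α : OneForm} :
    α ∈ dualForms s ↔ hodge α = s.sign • α := by
  rw [dualForms, LinearMap.mem_ker, LinearMap.sub_apply, sub_eq_zero]
  rfl

/-- An (anti-)self-dual form is trivial as an observable if and only if it lies in the image of
`d^± = ½ (id ± ∗) d`, so that the summand is indeed the quotient `Ω_c^{1,±} / d^± C_c^∞`. -/
theorem mkQ_eq_zero_iff {s : Chirality} {α : OneForm} (hα : α ∈ dualForms s) :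
    trivialForms.mkQ α = 0 ↔ ∃ f : CcCyl, α = dualProj s (dFun f) := by
  have hs : s.sign * s.sign = 1 := by cases s <;> simp [Chirality.sign]
  have hh : ∀ β : OneForm, hodge (hodge β) = β := fun β => Prod.ext rfl (neg_neg _)
  have hp : ∀ β, dualProj s β = (1 / 2 : ℝ) • (β + s.sign • hodge β) := fun _ => rfl
  have hf : dualProj s α = α := by
    rw [hp, mem_dualForms.1 hα, smul_smul, hs]
    module
  rw [Submodule.mkQ_apply, Submodule.Quotient.mk_eq_zero]
  constructor
  · intro h
    obtain ⟨_, ⟨f, rfl⟩, _, ⟨g, rfl⟩, h⟩ := Submodule.mem_sup.1 h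
    refine ⟨f + s.sign • g, ?_⟩
    rw [← hf, ← h, LinearMap.comp_apply, map_add, map_add dFun, map_add, map_smul dFun,
      hp (hodge _), hp (s.sign • _), hh, map_smul hodge, smul_smul s.sign, hs, one_smul,
      add_comm (hodge _)]
  · rintro ⟨f, rfl⟩
    rw [hp]
    exact trivialForms.smul_mem _ (trivialForms.add_mem (Submodule.mem_sup_left ⟨f, rfl⟩)
      (trivialForms.smul_mem _ (Submodule.mem_sup_right ⟨f, rfl⟩)))

/-- The closed compactly supported one-forms. -/
def closedForms : Submodule ℝ OneForm := LinearMap.ker dForm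

/-- The first compactly supported de Rham cohomology of the flat cylinder, closed forms modulo
exact forms, as a subspace of all one-forms modulo exact forms. -/
def H1c : Submodule ℝ (OneForm ⧸ LinearMap.range dFun) :=
  closedForms.map (LinearMap.range dFun).mkQ

/-- The map `[α] ↦ [α]` from cohomology to the linear observables. -/
def cohomObs : H1c →ₗ[ℝ] LinObs :=
  (LinearMap.range dFun).mapQ trivialForms LinearMap.id (fun _ h => Submodule.mem_sup_left h)
    ∘ₗ H1c.subtype

/-- The map `[β] ↦ [∗ β]` from cohomology to the linear observables. -/
def hodgeCohomObs : H1c →ₗ[ℝ] LinObs :=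
  (LinearMap.range dFun).mapQ trivialForms hodge
    (fun _ h => hodge_trivialForms (Submodule.mem_sup_left h)) ∘ₗ H1c.subtype

/-- The map `[α] ⊕ [β] ↦ [α + ∗ β]` from two copies of cohomology to the linear observables. -/
def cohomMap : H1c × H1c →ₗ[ℝ] LinObs := cohomObs.coprod hodgeCohomObs

/-- The (anti-)self-dual compactly supported cohomology: the component in the
(anti-)self-dual summand of the image of two copies of cohomology. -/
def dualCohom (s : Chirality) : Submodule ℝ LinObs := (LinearMap.range cohomMap).map (obsProj s)

/-- The subspaces
`𝔏⁺ = Ω_c^{1,-} / d⁻ C_c^∞ ⊕ H_c^{1,+}` and `𝔏⁻ = H_c^{1,-} ⊕ Ω_c^{1,+} / d⁺ C_c^∞` of the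
linear observables. -/
def chiralObs (s : Chirality) : Submodule ℝ LinObs := dualObs s.opp ⊔ dualCohom s

/-- The homomorphism `CCR(𝔏^±, τ) → CCR(𝔏, τ)` induced by the inclusion `𝔏^± ⊆ 𝔏`. -/
def chiralIncl (s : Chirality) : CCR (tauCyl.restrict (chiralObs s)) →⋆ₐ[ℂ] CylAlg :=
  CCR.map (chiralObs s).subtype fun _ _ => rfl

end

/-! Integrating `b dx⁻` along `x⁻` and `a dx⁺` along `x⁺` identifies 𝔏 with C^∞(𝕋) ⊕ C^∞(𝕋)
(`obsEquiv`). Indeed, a test function is `∂₋f` for a test function `f` exactly when its integrals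
along `x⁺ = const` vanish (`exists_dMinus_eq`), the same holds with the coordinates exchanged, and
all fibre integrals occur (`spread`). In this picture τ is the orthogonal sum of two copies of τ_𝕋
(`tauCyl_obsEquiv`), an endomorphism g acts on functions of `x^±` by composition with the inverse of
g^± (`obsEquiv_pushObs`), and 𝔏^± consists of all functions of `x^±` together with the constant
functions of `x^∓` (`mem_chiralObs`).

Since π_± is surjective on endomorphisms, a compatible family is determined by its value at the
identity, and an element of the algebra extends to a family if and only if the kernel of π_± fixes
it.

The heart is the computation of these invariants (`mem_range_chiralIncl`). The kernel acts through
arbitrary diffeomorphisms on the functions of `x^∓`, so it fixes the constants and hence CCR(𝔏^±).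
For the converse, take a circle diffeomorphism whose iterates move every point to 0 (`parabolic`),
and regard an invariant element as a polynomial function on the span of the point evaluations. Its
value at ℓ does not change when ℓ is composed with the n-th iterate. As n grows, these functionals
converge pointwise to ℓ composed with `collapse`, which evaluates functions of `x^∓` at 0. Values at
point functionals determine elements of the symmetric algebra (`eq_of_eval_eq`), so the element
equals its image under a projection onto 𝔏^±. The star product plays no role here: the action is the
linear functorial one on the symmetric algebra.

Finally, constants are null for τ_𝕋, so (𝔏^±, τ) is (C^∞(𝕋), τ_𝕋) ⊕ (ℝ, 0). A null summand generates
a central subalgebra with its ordinary product and splits off as a tensor factor (`prodZeroEquiv`).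
-/

noncomputable section

/-! ### Elements of the complexified symmetric algebra as polynomial functions -/

namespace SymC

variable {V W X : Type*} [AddCommGroup V] [Module ℝ V] [AddCommGroup W] [Module ℝ W]
  [AddCommGroup X] [Module ℝ X]

theorem algHom_ext {E : Type*} [Ring E] [Algebra ℂ E] {f g : SymC V →ₐ[ℂ] E}
    (h : ∀ v, f (ι v) = g (ι v)) : f = g := by
  refine AlgHom.ext fun a => ?_
  induction a using SymC.induction with
  | one => simp
  | smul c a ha => rw [map_smul, map_smul, ha]
  | add a b ha hb => rw [map_add, map_add, ha, hb]
  | ι_mul v a ha => rw [map_mul, map_mul, ha, h]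

theorem map_id_apply (a : SymC V) : map LinearMap.id a = a := by
  have : map (LinearMap.id : V →ₗ[ℝ] V) = AlgHom.id ℂ _ := algHom_ext fun v => by simp
  rw [this]; rfl

theorem map_map (g : W →ₗ[ℝ] X) (f : V →ₗ[ℝ] W) (a : SymC V) :
    map g (map f a) = map (g ∘ₗ f) a := by
  have : (map g).comp (map f) = map (g ∘ₗ f) := algHom_ext fun v => by simp
  rw [← this]; rfl

/-- Over a field an injective linear map has a linear left inverse, and functoriality carries the
splitting over to the symmetric algebras. -/
theorem map_injective {f : V →ₗ[ℝ] W} (hf : Function.Injective f) :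
    Function.Injective (map f) := by
  obtain ⟨r, hr⟩ := f.exists_leftInverse_of_injective (LinearMap.ker_eq_bot.2 hf)
  intro a b h
  have := congrArg (map r) h
  rwa [map_map, map_map, hr, map_id_apply, map_id_apply] at this

/-- Evaluation of polynomials at a linear functional. -/
def eval (ℓ : V →ₗ[ℝ] ℝ) : SymC V →ₐ[ℂ] ℂ :=
  lift (fun v => ((ℓ v : ℝ) : ℂ)) (by simp) (by simp) (fun _ _ => mul_comm _ _)

@[simp] theorem eval_ι (ℓ : V →ₗ[ℝ] ℝ) (v : V) : eval ℓ (ι v) = ((ℓ v : ℝ) : ℂ) :=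
  lift_ι _ _ _ _ v

theorem eval_map (ℓ : W →ₗ[ℝ] ℝ) (f : V →ₗ[ℝ] W) (a : SymC V) :
    eval ℓ (map f a) = eval (ℓ ∘ₗ f) a := by
  have : (eval ℓ).comp (map f) = eval (ℓ ∘ₗ f) := algHom_ext fun v => by simp
  rw [← this]; rfl

/-- Evaluation is continuous with respect to pointwise convergence of functionals. -/
theorem tendsto_eval {β : Type*} {F : Filter β} {ℓ : β → V →ₗ[ℝ] ℝ} {ℓ' : V →ₗ[ℝ] ℝ}
    (h : ∀ v, Filter.Tendsto (fun n => ℓ n v) F (nhds (ℓ' v))) (a : SymC V) :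
    Filter.Tendsto (fun n => eval (ℓ n) a) F (nhds (eval ℓ' a)) := by
  induction a using SymC.induction with
  | one => simpa using tendsto_const_nhds
  | smul c a ha => simpa only [map_smul] using ha.const_smul c
  | add a b ha hb => simpa only [map_add] using ha.add hb
  | ι_mul v a ha =>
    simp only [map_mul, eval_ι]
    exact ((Complex.continuous_ofReal.tendsto _).comp (h v)).mul ha

/-- An element is built from finitely many generators. This reduces separation by functionals to
polynomials in finitely many variables. -/
theorem exists_finiteDimensional (a : SymC V) :
    ∃ F : Submodule ℝ V, FiniteDimensional ℝ F ∧ a ∈ Set.range (map F.subtype) := by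
  have mono : ∀ {F G : Submodule ℝ V}, F ≤ G → ∀ {a},
      a ∈ Set.range (map F.subtype) → a ∈ Set.range (map G.subtype) := by
    rintro F G h _ ⟨b, rfl⟩
    refine ⟨map (Submodule.inclusion h) b, ?_⟩
    rw [map_map, Submodule.subtype_comp_inclusion]
  induction a using SymC.induction with
  | one => exact ⟨⊥, inferInstance, 1, map_one _⟩
  | smul c a ha =>
    obtain ⟨F, hF, b, rfl⟩ := ha
    exact ⟨F, hF, c • b, map_smul _ _ _⟩
  | add a b ha hb =>
    obtain ⟨F, hF, ha⟩ := ha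
    obtain ⟨G, hG, hb⟩ := hb
    obtain ⟨a', rfl⟩ := mono (le_sup_left : F ≤ F ⊔ G) ha
    obtain ⟨b', rfl⟩ := mono (le_sup_right : G ≤ F ⊔ G) hb
    exact ⟨F ⊔ G, inferInstance, a' + b', map_add _ _ _⟩
  | ι_mul v a ha =>
    obtain ⟨F, hF, ha⟩ := ha
    obtain ⟨a', rfl⟩ := mono (le_sup_left : F ≤ F ⊔ ℝ ∙ v) ha
    have hv : v ∈ F ⊔ ℝ ∙ v := Submodule.mem_sup_right (Submodule.mem_span_singleton_self v)
    exact ⟨F ⊔ ℝ ∙ v, inferInstance, ι ⟨v, hv⟩ * a', by rw [map_mul, map_ι]; rfl⟩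

/-- In coordinates the evaluations are the values of a complex polynomial at real points, and a
polynomial vanishing on a product of infinite sets is zero. -/
theorem eq_zero_of_eval_eq_zero_of_finite [FiniteDimensional ℝ V] {a : SymC V}
    (h : ∀ ℓ, eval ℓ a = 0) : a = 0 := by
  let b := Module.finBasis ℝ V
  let toPoly : SymC V →ₐ[ℂ] MvPolynomial (Fin (Module.finrank ℝ V)) ℂ :=
    lift (fun v => ∑ i, ((b.repr v i : ℝ) : ℂ) • MvPolynomial.X i)
      (fun v w => by simp [add_smul, Finset.sum_add_distrib, -Complex.coe_smul])
      (fun r v => by simp [Finset.smul_sum, mul_smul, -Complex.coe_smul])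
      (fun _ _ => mul_comm _ _)
  have toPoly_ι : ∀ v, toPoly (ι v) = ∑ i, ((b.repr v i : ℝ) : ℂ) • MvPolynomial.X i :=
    fun v => lift_ι _ _ _ _ v
  -- Only the injectivity of `toPoly` is needed, so a left inverse suffices.
  have hleft : (MvPolynomial.aeval (fun i => ι (b i))).comp toPoly = AlgHom.id ℂ (SymC V) := by
    refine algHom_ext fun v => ?_
    rw [AlgHom.comp_apply, toPoly_ι]
    simp only [map_sum, map_smul, MvPolynomial.aeval_X, AlgHom.id_apply, ← ι_smul]
    conv_rhs => rw [← b.sum_repr v, map_sum]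
    simp only [map_smul]
  have heval : ∀ r : Fin (Module.finrank ℝ V) → ℝ,
      MvPolynomial.eval (fun i => (r i : ℂ)) (toPoly a) = 0 := by
    intro r
    have : (MvPolynomial.aeval (fun i => (r i : ℂ))).comp toPoly = eval (b.constr ℝ r) := by
      refine algHom_ext fun v => ?_
      rw [AlgHom.comp_apply, toPoly_ι]
      simp [Module.Basis.constr_apply_fintype, -Complex.coe_smul]
    rw [← h (b.constr ℝ r), ← this, AlgHom.comp_apply, MvPolynomial.aeval_eq_eval]
  have hzero : toPoly a = 0 := by
    refine MvPolynomial.funext_set (fun _ => Set.range ((↑) : ℝ → ℂ)) (fun _ =>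
      Set.infinite_range_of_injective Complex.ofReal_injective) fun x hx => ?_
    choose r hr using fun i => hx i trivial
    rw [map_zero, ← heval r]
    simp only [hr]
  rw [← AlgHom.id_apply (R := ℂ) a, ← hleft, AlgHom.comp_apply, hzero, map_zero]

/-- A space of functionals that separates the points of `V` separates the points of its
complexified symmetric algebra. -/
theorem eq_of_eval_eq {D : Submodule ℝ (Module.Dual ℝ V)}
    (hD : ∀ v, (∀ ℓ ∈ D, ℓ v = 0) → v = 0) {a b : SymC V}
    (h : ∀ ℓ ∈ D, eval ℓ a = eval ℓ b) : a = b := by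
  rw [← sub_eq_zero]
  obtain ⟨F, hF, c, hc⟩ := exists_finiteDimensional (a - b)
  -- On the finite-dimensional space `F` a separating space of functionals is the whole dual,
  -- because it equals the annihilator of its coannihilator, which is zero. Thus every functional on
  -- `F` is the restriction of one in `D`.
  have hsurj : D.map F.dualRestrict = ⊤ := by
    rw [← Subspace.dualCoannihilator_dualAnnihilator_eq (W := D.map F.dualRestrict)]
    have : (D.map F.dualRestrict).dualCoannihilator = ⊥ := by
      refine (Submodule.eq_bot_iff _).2 fun v hv => ?_
      rw [Submodule.mem_dualCoannihilator] at hv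
      exact Subtype.ext (hD v fun ℓ hℓ => hv _ ⟨ℓ, hℓ, rfl⟩)
    rw [this, Submodule.dualAnnihilator_bot]
  have hc0 : c = 0 := by
    refine eq_zero_of_eval_eq_zero_of_finite fun ℓ => ?_
    obtain ⟨ℓ', hℓ', rfl⟩ : ℓ ∈ D.map F.dualRestrict := hsurj ▸ trivial
    have := eval_map ℓ' F.subtype c
    rw [hc, map_sub, h ℓ' hℓ', sub_self] at this
    exact this.symm
  rw [← hc, hc0, map_zero]

/-- The isomorphism `Sym V ⊗ Sym W ≅ Sym (V × W)`. -/
def prodEquiv : SymC V ⊗[ℂ] SymC W ≃ₐ[ℂ] SymC (V × W) :=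
  AlgEquiv.ofAlgHom
    (Algebra.TensorProduct.lift (map (LinearMap.inl ℝ V W)) (map (LinearMap.inr ℝ V W))
      (fun _ _ => Commute.all _ _))
    (lift (fun x => ι x.1 ⊗ₜ 1 + 1 ⊗ₜ ι x.2)
      (fun x y => by
        simp only [Prod.fst_add, Prod.snd_add, map_add, TensorProduct.add_tmul,
          TensorProduct.tmul_add]
        abel)
      (fun r x => by
        simp only [Prod.smul_fst, Prod.smul_snd, ι_smul, TensorProduct.tmul_smul, smul_add,
          ← TensorProduct.smul_tmul'])
      (fun _ _ => mul_comm _ _))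
    (algHom_ext fun x => by
      rw [AlgHom.comp_apply, lift_ι, map_add, Algebra.TensorProduct.lift_tmul,
        Algebra.TensorProduct.lift_tmul, map_one, map_one, one_mul, mul_one, map_ι, map_ι, ← map_add]
      simp)
    (Algebra.TensorProduct.ext
      (algHom_ext fun v => by
        simp [lift_ι])
      (algHom_ext fun v => by
        simp [lift_ι]))

theorem prodEquiv_tmul (a : SymC V) (b : SymC W) : prodEquiv (a ⊗ₜ[ℂ] b)
    = map (LinearMap.inl ℝ V W) a * map (LinearMap.inr ℝ V W) b := rfl

end SymC

/-! ### Functoriality of CCR algebras and splitting off null directions -/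

namespace CCR

variable {V W : Type*} [AddCommGroup V] [Module ℝ V] [AddCommGroup W] [Module ℝ W]

theorem map_injective {τ : PoissonForm V} {σ : PoissonForm W} {f : V →ₗ[ℝ] W}
    (hf : ∀ v w, σ.form (f v) (f w) = τ.form v w) (hinj : Function.Injective f) :
    Function.Injective (map f hf) := SymC.map_injective hinj

/-- The CCR algebras of isomorphic Poisson vector spaces are isomorphic. -/
def congr {τ : PoissonForm V} {σ : PoissonForm W} (e : V ≃ₗ[ℝ] W)
    (he : ∀ v w, σ.form (e v) (e w) = τ.form v w) : CCR τ ≃⋆ₐ[ℂ] CCR σ :=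
  StarAlgEquiv.ofBijective (map e.toLinearMap he) ⟨map_injective he e.injective, fun b =>
    ⟨SymC.map (V := W) e.symm.toLinearMap b, by
      refine (SymC.map_map _ _ (show SymC W from b)).trans ?_
      rw [LinearEquiv.comp_coe, LinearEquiv.symm_trans_self]
      exact SymC.map_id_apply (show SymC W from b)⟩⟩

end CCR

/-- The extension of a Poisson structure by zero to a product. -/
def PoissonForm.prodZero {V : Type*} [AddCommGroup V] [Module ℝ V] (τ : PoissonForm V)
    (W : Type*) [AddCommGroup W] [Module ℝ W] : PoissonForm (V × W) where
  form := τ.form.compl₁₂ (LinearMap.fst ℝ V W) (LinearMap.fst ℝ V W)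
  alt v := τ.alt v.1

theorem SymC.contract_zero {V : Type*} [AddCommGroup V] [Module ℝ V] (a : SymC V) :
    contract (0 : V →ₗ[ℝ] ℝ) a = 0 := by
  have := contract_smul 0 (0 : V →ₗ[ℝ] ℝ) a
  simpa using this

namespace CCR

variable {V W : Type*} [AddCommGroup V] [Module ℝ V] [AddCommGroup W] [Module ℝ W]

-- Vectors of `W` lie in the radical of the extended form. Contraction with them vanishes, and with
-- it every correction term in the recursion `moyal_ι_mul`.
open SymC in
theorem moyal_map_inr (τ : PoissonForm V) (a : SymC W) (b : SymC (V × W)) :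
    moyal (τ.prodZero W) (SymC.map (LinearMap.inr ℝ V W) a) b
      = SymC.map (LinearMap.inr ℝ V W) a * b := by
  induction a using SymC.induction with
  | one => rw [map_one, moyal_one, one_mul]
  | smul c a h => rw [map_smul, moyal_smul_left, h, smul_mul_assoc]
  | add a a' h h' => rw [map_add, moyal_add_left, h, h', add_mul]
  | ι_mul w a h =>
    have h0 : (τ.prodZero W).form (LinearMap.inr ℝ V W w) = 0 := by
      ext x <;> simp [PoissonForm.prodZero]
    rw [map_mul, map_ι, moyal_ι_mul, h, h0, contract_zero, moyal_zero_right, smul_zero, add_zero,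
      mul_assoc]

-- Conjugation reverses the star product and preserves the commutative one, so it turns the
-- left-hand version into this one. Together the two show that `Sym W` is central.
open SymC in
theorem moyal_map_inr_right (τ : PoissonForm V) (a : SymC W) (b : SymC (V × W)) :
    moyal (τ.prodZero W) b (SymC.map (LinearMap.inr ℝ V W) a)
      = b * SymC.map (LinearMap.inr ℝ V W) a := by
  have h := congrArg conj (moyal_map_inr τ (conj a) (conj b))
  rwa [conj_moyal, conj_conj, map_mul, conj_conj, map_conj, conj_conj, mul_comm] at h

/-- The CCR algebra of `(V × W, τ ⊕ 0)` is the tensor product of the CCR algebra of `(V, τ)` and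
the symmetric algebra of `W`. -/
def prodZeroEquiv (τ : PoissonForm V) :
    (CCR τ ⊗[ℂ] SymC W) ≃⋆ₐ[ℂ] CCR (τ.prodZero W) := by
  let i : CCR τ →ₐ[ℂ] CCR (τ.prodZero W) :=
    (CCR.map (LinearMap.inl ℝ V W) (fun _ _ => rfl) : CCR τ →⋆ₐ[ℂ] CCR (τ.prodZero W)).toAlgHom
  let j : SymC W →ₐ[ℂ] CCR (τ.prodZero W) :=
    AlgHom.ofLinearMap (SymC.map (LinearMap.inr ℝ V W)).toLinearMap (map_one (SymC.map _))
      (fun a b => (map_mul (SymC.map _) a b).trans (moyal_map_inr τ a _).symm)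
  let Θ : CCR τ ⊗[ℂ] SymC W →ₐ[ℂ] CCR (τ.prodZero W) :=
    Algebra.TensorProduct.lift i j (fun a b =>
      (moyal_map_inr_right τ b _).trans ((mul_comm _ _).trans (moyal_map_inr τ b _).symm))
  have hΘ : ∀ (a : CCR τ) (b : SymC W), Θ (a ⊗ₜ b) = SymC.prodEquiv (V := V) (a ⊗ₜ b) := by
    intro a b
    refine (Algebra.TensorProduct.lift_tmul _ _ _ a b).trans ?_
    exact moyal_map_inr_right τ b _
  -- As a map of vector spaces `Θ` is the isomorphism `Sym V ⊗ Sym W ≅ Sym (V × W)` of commutative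
  -- algebras. Bijectivity is inherited from there, without constructing an inverse for the star
  -- product.
  have hΘ' : ∀ t : CCR τ ⊗[ℂ] SymC W,
      Θ t = SymC.prodEquiv (V := V) (W := W) (show SymC V ⊗[ℂ] SymC W from t) := by
    intro t
    induction t using TensorProduct.induction_on with
    | zero => exact (map_zero Θ).trans (map_zero (SymC.prodEquiv (V := V) (W := W))).symm
    | tmul a b => exact hΘ a b
    | add x y hx hy =>
      exact (map_add Θ x y).trans ((congrArg₂ _ hx hy).trans
        (map_add (SymC.prodEquiv (V := V) (W := W)) x y).symm)
  refine StarAlgEquiv.ofBijective (⟨Θ, fun t => ?_⟩ : _ →⋆ₐ[ℂ] _) ?_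
  -- On pure tensors `Θ` is a commutative product, for which conjugation is multiplicative.
  · change Θ (star t) = star (Θ t)
    induction t using TensorProduct.induction_on with
    | zero => rw [star_zero, map_zero, star_zero]
    | tmul a b =>
      rw [TensorProduct.star_tmul, hΘ, hΘ]
      refine (SymC.prodEquiv_tmul _ _).trans ?_
      refine (congrArg₂ (· * ·) (SymC.map_conj _ _) (SymC.map_conj _ _)).trans ?_
      exact (map_mul SymC.conj _ _).symm
    | add x y hx hy => rw [star_add, map_add, hx, hy, map_add, star_add]
  · have : (Θ : CCR τ ⊗[ℂ] SymC W → CCR (τ.prodZero W)) =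
        (SymC.prodEquiv (V := V) (W := W) : SymC V ⊗[ℂ] SymC W → SymC (V × W)) := funext hΘ'
    change Function.Bijective Θ
    rw [this]
    exact (SymC.prodEquiv (V := V) (W := W)).bijective

end CCR

/-! ### Exactness of fiber integration -/

namespace CcCyl

open MeasureTheory
open scoped Convolution

/-- The primitive of a test function along the light rays `x⁺ = const`. -/
def primFun (a : CcCyl) : Cyl → ℝ :=
  Cyl.lift (fun x => ∫ s in Set.Iic (0 : ℝ), a.1 ((x.1, x.2 + s) : ℝ × ℝ)) fun x n => by
    refine integral_congr_ae (Filter.Eventually.of_forall fun s => ?_)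
    have := Cyl.mk_shift (x.1, x.2 + s) n
    simp only at this ⊢
    rw [← this, add_sub_right_comm]

theorem primFun_mk (a : CcCyl) (u v : ℝ) :
    primFun a ((u, v) : ℝ × ℝ) = ∫ w in Set.Iic v, a.1 ((u, w) : ℝ × ℝ) := by
  change ∫ s in Set.Iic (0 : ℝ), a.1 ((u, v + s) : ℝ × ℝ) = _
  rw [← integral_indicator measurableSet_Iic, ← integral_indicator measurableSet_Iic,
    ← integral_add_left_eq_self ((Set.Iic v).indicator fun w => a.1 ((u, w) : ℝ × ℝ)) v]
  congr 1
  funext s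
  simp [Set.indicator_apply]

theorem hasDerivAt_primFun (a : CcCyl) (u v : ℝ) :
    HasDerivAt (fun v : ℝ => primFun a ((u, v) : ℝ × ℝ)) (a.1 ((u, v) : ℝ × ℝ)) v := by
  have hc := (a.slice_smooth u).continuous
  have h : (fun v : ℝ => primFun a ((u, v) : ℝ × ℝ)) = fun v =>
      (∫ w in (0 : ℝ)..v, a.1 ((u, w) : ℝ × ℝ)) + primFun a ((u, (0 : ℝ)) : ℝ × ℝ) := by
    funext v
    rw [primFun_mk, primFun_mk, ← intervalIntegral.integral_Iic_sub_Iic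
      (a.slice_integrable u).integrableOn (a.slice_integrable u).integrableOn, sub_add_cancel]
  rw [h]
  exact (hc.integral_hasStrictDerivAt 0 v).hasDerivAt.add_const _

/-- The primitive is the convolution of a slice of `a` with the Heaviside function. Joint smoothness
in the slice parameter and the variable is then smoothness of convolutions depending on a parameter.
-/
theorem contDiff_primFun (a : CcCyl) : ContDiff ℝ ∞ (fun x : ℝ × ℝ => primFun a x) := by
  obtain ⟨R, hR⟩ := a.exists_bound
  rw [contDiff_iff_contDiffAt]
  rintro ⟨u, v⟩
  have hf : LocallyIntegrable ((Set.Ici (0 : ℝ)).indicator fun _ => (1 : ℝ)) :=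
    (locallyIntegrable_const 1).indicator measurableSet_Ici
  -- The slices at parameters within distance 1 of `u` must be supported in one compact set. The
  -- slice at `p` lives in `[-R - p, R - p]`, which explains the extra 1 at both ends of the
  -- interval.
  have h := contDiffOn_convolution_right_with_param (n := ⊤) (ContinuousLinearMap.mul ℝ ℝ)
    (g := fun (u v : ℝ) => a.1 ((u, v) : ℝ × ℝ)) (s := Metric.ball u 1)
    (k := Set.Icc (-R - u - 1) (R - u + 1)) Metric.isOpen_ball isCompact_Icc
    (fun p x hp hx => by
      refine hR (p, x) ?_
      by_contra h
      obtain ⟨h1, h2⟩ := abs_le.1 (not_lt.1 h)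
      rw [Metric.mem_ball, Real.dist_eq] at hp
      obtain ⟨h3, h4⟩ := abs_lt.1 hp
      simp only at h1 h2
      exact hx ⟨by linarith, by linarith⟩) hf
    (a.smooth.contDiffOn)
  have heq : (fun q : ℝ × ℝ => (((Set.Ici (0 : ℝ)).indicator fun _ => (1 : ℝ))
      ⋆[ContinuousLinearMap.mul ℝ ℝ, volume] (fun v : ℝ => a.1 ((q.1, v) : ℝ × ℝ))) q.2)
      = fun x : ℝ × ℝ => primFun a x := by
    funext x
    change ∫ t, (Set.Ici (0 : ℝ)).indicator (fun _ => (1 : ℝ)) t * a.1 ((x.1, x.2 - t) : ℝ × ℝ)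
      = ∫ s in Set.Iic (0 : ℝ), a.1 ((x.1, x.2 + s) : ℝ × ℝ)
    rw [← integral_indicator measurableSet_Iic, ← integral_neg_eq_self]
    congr 1
    funext s
    simp [Set.indicator_apply]
  rw [heq] at h
  exact h.contDiffAt (prod_mem_nhds (Metric.ball_mem_nhds u one_pos) Filter.univ_mem)

/-- A test function with vanishing integrals along the light rays `x⁺ = const` is a derivative. -/
theorem exists_dMinus_eq {a : CcCyl} (h : fiberPlus a = 0) : ∃ f : CcCyl, dMinus f = a := by
  obtain ⟨R, hR⟩ := a.exists_bound
  have hsupp : HasCompactSupport (primFun a) := by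
    refine Cyl.hasCompactSupport_of_bound (R := R) ?_
    rintro ⟨u, v⟩ hx
    rw [primFun_mk]
    simp only at hx
    -- Beyond the support of `a` the half-line integral is the full fibre integral, which is zero by
    -- `h`. Before the support the integrand itself vanishes.
    rcases lt_abs.1 hx with hx | hx
    · rw [setIntegral_eq_integral_of_forall_compl_eq_zero, ← fiberPlus_coe, h]
      · rfl
      · intro w hw
        rw [Set.mem_Iic, not_le] at hw
        exact hR (u, w) (lt_abs.2 (Or.inl (by simp only; linarith)))
    · refine setIntegral_eq_zero_of_forall_eq_zero fun w hw => ?_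
      rw [Set.mem_Iic] at hw
      exact hR (u, w) (lt_abs.2 (Or.inr (by simp only; linarith)))
  refine ⟨⟨primFun a, contDiff_primFun a, hsupp⟩, ?_⟩
  ext p
  induction p using QuotientAddGroup.induction_on with
  | H x => exact (hasDerivAt_minus _ x.1 x.2).unique (hasDerivAt_primFun a x.1 x.2)

theorem swap_swap (f : CcCyl) : swap (swap f) = f := by
  ext p
  induction p using QuotientAddGroup.induction_on with
  | H x => rfl

theorem exists_dPlus_eq {a : CcCyl} (h : fiberMinus a = 0) : ∃ f : CcCyl, dPlus f = a := by
  obtain ⟨f, hf⟩ := exists_dMinus_eq h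
  exact ⟨swap f, by rw [dPlus_swap, hf, swap_swap]⟩

/-! ### Realizing prescribed fibre integrals -/

/-- A smooth profile on the line with compact support and integral one. -/
def profile : ContDiffBump (0 : ℝ) := ⟨1, 2, one_pos, one_lt_two⟩

/-- A test function with integrals `φ(x⁺)` along the light rays `x⁺ = const`. -/
def spread (φ : SmoothCircle) : CcCyl :=
  ⟨Cyl.lift (fun x => φ.1 (x.1 : UnitAddCircle) * profile.normed volume (x.1 + x.2))
    (fun x n => by
      congr 1
      · simp
      · congr 1
        ring), by
    refine ⟨(φ.smooth.comp contDiff_fst).mul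
      (profile.contDiff_normed.comp (contDiff_fst.add contDiff_snd)), ?_⟩
    -- The 2 is the outer radius of `profile`.
    refine Cyl.hasCompactSupport_of_bound (R := 2) fun x hx => ?_
    have : profile.normed volume (x.1 + x.2) = 0 := by
      rw [← Function.notMem_support, profile.support_normed_eq, Metric.mem_ball, dist_zero_right]
      exact not_lt.2 hx.le
    exact mul_eq_zero_of_right _ this⟩

theorem spread_mk (φ : SmoothCircle) (u v : ℝ) : (spread φ).1 ((u, v) : ℝ × ℝ)
    = φ.1 (u : UnitAddCircle) * profile.normed volume (u + v) := rfl

theorem fiberPlus_spread (φ : SmoothCircle) : fiberPlus (spread φ) = φ := by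
  ext p
  induction p using QuotientAddGroup.induction_on with
  | H u =>
    refine (fiberPlus_coe _ u).trans ?_
    simp only [spread_mk]
    rw [integral_const_mul, integral_add_left_eq_self (profile.normed volume) u,
      profile.integral_normed, mul_one]

theorem fiberMinus_swap_spread (φ : SmoothCircle) : fiberMinus (swap (spread φ)) = φ := by
  rw [fiberMinus_eq, swap_swap, fiberPlus_spread]

end CcCyl

/-! ### Constant functions on the circle -/

namespace SmoothCircle

/-- The constant functions on the circle. -/
def const : ℝ →ₗ[ℝ] SmoothCircle where
  toFun c := ⟨fun _ => c, (contDiff_const : ContDiff ℝ ∞ fun _ : ℝ => c)⟩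
  map_add' _ _ := rfl
  map_smul' _ _ := rfl

theorem const_injective : Function.Injective const := fun _ _ h =>
  congrArg (fun φ : SmoothCircle => φ.1 0) h

/-- Evaluation of smooth functions at a point of the circle. -/
def evalAt (p : UnitAddCircle) : SmoothCircle →ₗ[ℝ] ℝ :=
  LinearMap.proj p ∘ₗ smoothCircle.subtype

theorem mem_range_const {φ : SmoothCircle} (h : ∀ x : ℝ, deriv (fun x : ℝ => φ.1 x) x = 0) :
    φ ∈ LinearMap.range const := by
  refine ⟨φ.1 (0 : ℝ), ?_⟩
  ext p
  induction p using QuotientAddGroup.induction_on with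
  | H x => exact is_const_of_deriv_eq_zero (φ.smooth.differentiable (by simp)) h _ _

/-- The form contains the derivative of its second argument. This nullity makes the cohomological
summand central, so that it contributes a commutative factor `Sym ℝ`. -/
theorem poisson_const_right (φ : SmoothCircle) (c : ℝ) : poisson.form φ (const c) = 0 := by
  have : ∀ x : ℝ, deriv (fun y : ℝ => (const c).1 y) x = 0 := fun x =>
    (hasDerivAt_const x c).deriv
  rw [poisson_apply]
  simp only [this]
  simp

end SmoothCircle

/-! ### The linear observables as pairs of functions on the circle -/

/-- Exactness in each light-cone direction makes the components `∂₊f` and `∂₋g`, with unrelated `f`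
and `g`. Having both `d` and `∗ d` available decouples the two components. -/
theorem mem_trivialForms_of_fiber {α : OneForm} (h1 : CcCyl.fiberMinus α.1 = 0)
    (h2 : CcCyl.fiberPlus α.2 = 0) : α ∈ trivialForms := by
  obtain ⟨f, hf⟩ := CcCyl.exists_dPlus_eq h1
  obtain ⟨g, hg⟩ := CcCyl.exists_dMinus_eq h2
  -- The potentials F of `d` and H of `∗ d` must satisfy F + H = f in the `dx⁺` component and F - H
  -- = g in the `dx⁻` component.
  refine Submodule.mem_sup.2 ⟨_, ⟨(1 / 2 : ℝ) • (f + g), rfl⟩, _, ⟨(1 / 2 : ℝ) • (f - g), rfl⟩, ?_⟩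
  refine Prod.ext ?_ ?_
  · change CcCyl.dPlus _ + CcCyl.dPlus _ = _
    rw [← map_add, ← hf]
    congr 1
    module
  · change CcCyl.dMinus _ + -CcCyl.dMinus _ = _
    rw [← map_neg, ← map_add, ← hg]
    congr 1
    module

/-- The components of a pair, the one belonging to a chirality first. -/
def Chirality.sort {X : Type*} [AddCommGroup X] [Module ℝ X] : Chirality → (X × X) ≃ₗ[ℝ] X × X
  | .plus => LinearEquiv.refl ℝ _
  | .minus => LinearEquiv.prodComm ℝ X X

/-- The fiber integrals of a one-form; the first one is a function of `x^±`. -/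
def fiberPair (s : Chirality) : OneForm →ₗ[ℝ] SmoothCircle × SmoothCircle :=
  s.sort.toLinearMap ∘ₗ (CcCyl.fiberPlus ∘ₗ LinearMap.snd ℝ CcCyl CcCyl).prod
    (CcCyl.fiberMinus ∘ₗ LinearMap.fst ℝ CcCyl CcCyl)

theorem mem_trivialForms_iff (s : Chirality) {α : OneForm} :
    α ∈ trivialForms ↔ fiberPair s α = 0 := by
  have : fiberPair s α = 0 ↔ CcCyl.fiberMinus α.1 = 0 ∧ CcCyl.fiberPlus α.2 = 0 := by
    rw [fiberPair, LinearMap.comp_apply, LinearEquiv.coe_coe, LinearEquiv.map_eq_zero_iff,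
      and_comm]
    exact Prod.ext_iff
  rw [this]
  exact ⟨trivialForms_fiber, fun h => mem_trivialForms_of_fiber h.1 h.2⟩

/-- The linear observables are pairs of smooth functions on the circle, the fiber integrals. The
first function is a function of `x^±`. -/
def obsEquiv (s : Chirality) : LinObs ≃ₗ[ℝ] SmoothCircle × SmoothCircle :=
  LinearEquiv.ofBijective
    (trivialForms.liftQ (fiberPair s) fun _ h => (mem_trivialForms_iff s).1 h) (by
    constructor
    · exact LinearMap.ker_eq_bot.1 (Submodule.ker_liftQ_eq_bot _ _ _
        fun _ h => (mem_trivialForms_iff s).2 h)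
    · intro φ
      obtain ⟨ψ, rfl⟩ := s.sort.surjective φ
      refine ⟨trivialForms.mkQ (CcCyl.swap (CcCyl.spread ψ.2), CcCyl.spread ψ.1), ?_⟩
      exact congrArg s.sort (Prod.ext (CcCyl.fiberPlus_spread _)
        (CcCyl.fiberMinus_swap_spread _)))

/-- The propagator of an exact two-form is a sum of a function of `x⁺` and a function of `x⁻`, so in
`tauForm_eq` the two chiralities are orthogonal. -/
theorem tauCyl_obsEquiv (s : Chirality) (v w : LinObs) : tauCyl.form v w
    = SmoothCircle.poisson.form (obsEquiv s v).1 (obsEquiv s w).1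
      + SmoothCircle.poisson.form (obsEquiv s v).2 (obsEquiv s w).2 := by
  induction v using Submodule.Quotient.induction_on with
  | H α =>
    induction w using Submodule.Quotient.induction_on with
    | H β =>
      refine (tauForm_eq α β).trans ?_
      cases s
      -- `tauForm_eq` puts the functions of `x⁻` first, whereas `fiberPair .plus` puts the function
      -- of `x⁺` first.
      · exact add_comm _ _
      · rfl

theorem eq_zero_of_eq_neg {V : Type*} [AddCommGroup V] [Module ℝ V] {v : V} (h : v = -v) :
    v = 0 := by
  have h2 : (2 : ℝ) • v = 0 := by
    rw [two_smul]
    exact eq_neg_iff_add_eq_zero.1 h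
  exact (smul_eq_zero.1 h2).resolve_left two_ne_zero

/-- Duality and coordinate are crossed: a form `b dx⁻` is integrated along `x⁻` and leaves a
function of `x⁺`. The summand of duality opposite to `s` therefore corresponds to the functions of
the coordinate `x^±` belonging to `s`. -/
theorem mem_dualObs_opp {s : Chirality} {v : LinObs} :
    v ∈ dualObs s.opp ↔ (obsEquiv s v).2 = 0 := by
  constructor
  · rintro ⟨α, hα, rfl⟩
    have h := mem_dualForms.1 hα
    cases s
    · have h1 : α.1 = (-1 : ℝ) • α.1 := congrArg Prod.fst h
      have h2 : α.1 = 0 := eq_zero_of_eq_neg (h1.trans (neg_one_smul ℝ α.1))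
      change CcCyl.fiberMinus α.1 = 0
      rw [h2, map_zero]
    · have h1 : -α.2 = (1 : ℝ) • α.2 := congrArg Prod.snd h
      have h2 : α.2 = 0 := eq_zero_of_eq_neg (h1.trans (one_smul ℝ α.2)).symm
      change CcCyl.fiberPlus α.2 = 0
      rw [h2, map_zero]
  · intro h
    induction v using Submodule.Quotient.induction_on with
    | H α =>
      -- A representative need not itself be of the required duality. Dropping its other component,
      -- whose fibre integral vanishes, does not change the class.
      cases s
      · refine ⟨(0, α.2), mem_dualForms.2 (Prod.ext ?_ ?_), (obsEquiv .plus).injective ?_⟩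
        · exact (smul_zero _).symm
        · exact (neg_one_smul ℝ α.2).symm
        · exact Prod.ext rfl ((map_zero CcCyl.fiberMinus).trans h.symm)
      · refine ⟨(α.1, 0), mem_dualForms.2 (Prod.ext ?_ ?_), (obsEquiv .minus).injective ?_⟩
        · exact (one_smul ℝ α.1).symm
        · exact neg_zero.trans (smul_zero _).symm
        · exact Prod.ext rfl ((map_zero CcCyl.fiberPlus).trans h.symm)

theorem obsEquiv_obsProj (s : Chirality) (v : LinObs) :
    obsEquiv s (obsProj s v) = (0, (obsEquiv s v).2) := by
  induction v using Submodule.Quotient.induction_on with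
  | H α =>
    change fiberPair s (dualProj s α) = (0, (fiberPair s α).2)
    cases s
    · have : dualProj .plus α = (α.1, 0) := by
        refine Prod.ext ?_ ?_
        · change (1 / 2 : ℝ) • (α.1 + (1 : ℝ) • α.1) = α.1
          module
        · change (1 / 2 : ℝ) • (α.2 + (1 : ℝ) • -α.2) = 0
          module
      rw [this]
      exact Prod.ext (map_zero CcCyl.fiberPlus) rfl
    · have : dualProj .minus α = (0, α.2) := by
        refine Prod.ext ?_ ?_
        · change (1 / 2 : ℝ) • (α.1 + (-1 : ℝ) • α.1) = 0
          module
        · change (1 / 2 : ℝ) • (α.2 + (-1 : ℝ) • -α.2) = α.2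
          module
      rw [this]
      exact Prod.ext (map_zero CcCyl.fiberMinus) rfl

/-- Closed forms have constant fiber integrals. -/
theorem fiberPair_closed (s : Chirality) {α : OneForm} (h : α ∈ closedForms) :
    (fiberPair s α).2 ∈ LinearMap.range SmoothCircle.const := by
  -- Differentiating the fibre integral of one component integrates its transversal derivative.
  -- Closedness turns this into a derivative along the fibre, whose integral vanishes.
  have h' : CcCyl.dMinus α.1 = CcCyl.dPlus α.2 := sub_eq_zero.1 h
  cases s
  · refine SmoothCircle.mem_range_const fun x => ?_
    refine (CcCyl.fiberMinus_dMinus α.1 x).symm.trans ?_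
    rw [h', CcCyl.fiberMinus_dPlus]
    rfl
  · refine SmoothCircle.mem_range_const fun x => ?_
    refine (CcCyl.fiberPlus_dPlus α.2 x).symm.trans ?_
    rw [← h', CcCyl.fiberPlus_dMinus]
    rfl

/-- Within one duality the Hodge operator is a sign, so the second copy of cohomology adds nothing
to `dualCohom`. -/
theorem fiberPair_hodge (s : Chirality) (α : OneForm) :
    (fiberPair s (hodge α)).2 = s.sign • (fiberPair s α).2 := by
  cases s
  · exact (one_smul ℝ _).symm
  · exact (map_neg CcCyl.fiberPlus _).trans (neg_one_smul ℝ _).symm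

/-- The closed one-form `χ(x⁺ + x⁻) (dx⁺ + dx⁻)`, a multiple of the differential of time. -/
def timeForm : OneForm := (CcCyl.spread (SmoothCircle.const 1), CcCyl.spread (SmoothCircle.const 1))

theorem timeForm_closed : timeForm ∈ closedForms := by
  refine sub_eq_zero.2 ?_
  ext p
  induction p using QuotientAddGroup.induction_on with
  | H x =>
    obtain ⟨u, v⟩ := x
    have hd : HasDerivAt (CcCyl.profile.normed MeasureTheory.volume)
        (deriv (CcCyl.profile.normed MeasureTheory.volume) (u + v)) (u + v) :=
      ((CcCyl.profile.contDiff_normed (n := 1)).differentiable (by simp) _).hasDerivAt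
    exact ((CcCyl.hasDerivAt_minus timeForm.1 u v).unique
      ((hd.comp_const_add u v).const_mul (1 : ℝ))).trans
      ((CcCyl.hasDerivAt_plus timeForm.2 u v).unique
        ((hd.comp_add_const u v).const_mul (1 : ℝ))).symm

/-- The profile has integral one and depends on `x⁺ + x⁻` only, so it looks the same along both
families of light rays. Multiples of this one closed form realize all constants. -/
theorem fiberPair_timeForm (s : Chirality) : (fiberPair s timeForm).2 = SmoothCircle.const 1 := by
  cases s
  · have : CcCyl.spread (SmoothCircle.const 1) = CcCyl.swap (CcCyl.spread (SmoothCircle.const 1)) := by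
      ext p
      induction p using QuotientAddGroup.induction_on with
      | H x =>
        change 1 * _ = 1 * _
        rw [add_comm]
    change CcCyl.fiberMinus (CcCyl.spread _) = _
    rw [this, CcCyl.fiberMinus_swap_spread]
  · exact CcCyl.fiberPlus_spread _

/-- Closed forms have constant fibre integrals, the Hodge operator only changes a sign, and
`timeForm` attains every constant. -/
theorem mem_dualCohom {s : Chirality} {v : LinObs} : v ∈ dualCohom s ↔
    (obsEquiv s v).1 = 0 ∧ (obsEquiv s v).2 ∈ LinearMap.range SmoothCircle.const := by
  constructor
  · rintro ⟨_, ⟨⟨⟨_, α, hα, rfl⟩, ⟨_, β, hβ, rfl⟩⟩, rfl⟩, rfl⟩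
    rw [obsEquiv_obsProj]
    refine ⟨rfl, ?_⟩
    change (fiberPair s (α + hodge β)).2 ∈ LinearMap.range SmoothCircle.const
    rw [map_add, Prod.snd_add, fiberPair_hodge]
    exact add_mem (fiberPair_closed s hα) (Submodule.smul_mem _ _ (fiberPair_closed s hβ))
  · rintro ⟨h1, c, hc⟩
    refine ⟨_, ⟨(⟨_, c • timeForm, closedForms.smul_mem c timeForm_closed, rfl⟩, 0), rfl⟩, ?_⟩
    apply (obsEquiv s).injective
    rw [obsEquiv_obsProj]
    refine Prod.ext h1.symm ?_
    rw [← hc, cohomMap, LinearMap.coprod_apply, map_zero, add_zero]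
    change (fiberPair s (c • timeForm)).2 = _
    rw [map_smul, Prod.smul_snd, fiberPair_timeForm, ← map_smul, smul_eq_mul, mul_one]

/-- The two summands become C^∞(𝕋) × 0 and 0 × ℝ in the fibre-integral picture. -/
theorem mem_chiralObs {s : Chirality} {v : LinObs} : v ∈ chiralObs s ↔
    (obsEquiv s v).2 ∈ LinearMap.range SmoothCircle.const := by
  rw [chiralObs, Submodule.mem_sup]
  constructor
  · rintro ⟨x, hx, y, hy, rfl⟩
    rw [map_add, Prod.snd_add, mem_dualObs_opp.1 hx, zero_add]
    exact (mem_dualCohom.1 hy).2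
  · intro h
    refine ⟨(obsEquiv s).symm ((obsEquiv s v).1, 0), mem_dualObs_opp.2 (by simp),
      (obsEquiv s).symm (0, (obsEquiv s v).2), mem_dualCohom.2 (by simpa using h), ?_⟩
    rw [← map_add, Prod.mk_add_mk, add_zero, zero_add, Prod.mk.eta, LinearEquiv.symm_apply_apply]

theorem disjoint_dualObs_dualCohom (s : Chirality) : Disjoint (dualObs s.opp) (dualCohom s) := by
  refine Submodule.disjoint_def.2 fun v h1 h2 => (obsEquiv s).map_eq_zero_iff.1 ?_
  exact Prod.ext (mem_dualCohom.1 h2).1 (mem_dualObs_opp.1 h1)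

theorem finrank_dualCohom (s : Chirality) : Module.finrank ℝ (dualCohom s) = 1 := by
  let i : ℝ →ₗ[ℝ] LinObs :=
    (obsEquiv s).symm.toLinearMap ∘ₗ LinearMap.inr ℝ _ _ ∘ₗ SmoothCircle.const
  have hi : Function.Injective i := (obsEquiv s).symm.injective.comp
    (LinearMap.inr_injective.comp SmoothCircle.const_injective)
  have hr : LinearMap.range i = dualCohom s := by
    ext v
    rw [mem_dualCohom]
    constructor
    · rintro ⟨c, rfl⟩
      simp [i]
    · rintro ⟨h1, c, hc⟩
      refine ⟨c, (obsEquiv s).injective ?_⟩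
      simp only [i, LinearMap.comp_apply, LinearEquiv.coe_coe, LinearEquiv.apply_symm_apply]
      exact Prod.ext h1.symm hc
  rw [← hr, LinearMap.finrank_range_of_inj hi, Module.finrank_self]

/-- The isomorphism `C^∞(𝕋) ⊕ ℝ ≅ 𝔏^±`. -/
def chiralObsEquiv (s : Chirality) : (SmoothCircle × ℝ) ≃ₗ[ℝ] chiralObs s :=
  LinearEquiv.ofBijective
    (LinearMap.codRestrict (chiralObs s)
      ((obsEquiv s).symm.toLinearMap ∘ₗ LinearMap.prodMap LinearMap.id SmoothCircle.const)
      fun x => mem_chiralObs.2 (by simp)) (by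
    constructor
    · refine Function.Injective.codRestrict _ ((obsEquiv s).symm.injective.comp ?_)
      exact Function.injective_id.prodMap SmoothCircle.const_injective
    · rintro ⟨v, hv⟩
      obtain ⟨c, hc⟩ := mem_chiralObs.1 hv
      refine ⟨((obsEquiv s v).1, c), Subtype.ext ((obsEquiv s).injective ?_)⟩
      refine ((obsEquiv s).apply_symm_apply _).trans (Prod.ext rfl hc))

theorem obsEquiv_chiralObsEquiv (s : Chirality) (x : SmoothCircle × ℝ) :
    obsEquiv s (chiralObsEquiv s x).1 = (x.1, SmoothCircle.const x.2) :=
  (obsEquiv s).apply_symm_apply _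

/-- The second of the two orthogonal circle forms is restricted to constants, where it vanishes. -/
theorem tauCyl_chiralObsEquiv (s : Chirality) (x y : SmoothCircle × ℝ) :
    (tauCyl.restrict (chiralObs s)).form (chiralObsEquiv s x) (chiralObsEquiv s y)
      = (SmoothCircle.poisson.prodZero ℝ).form x y := by
  refine (tauCyl_obsEquiv s _ _).trans ?_
  rw [Submodule.subtype_apply, Submodule.subtype_apply, obsEquiv_chiralObsEquiv,
    obsEquiv_chiralObsEquiv, SmoothCircle.poisson_const_right, add_zero]
  rfl

/-! ### A contraction of the circle -/

namespace LiftDiff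

/-- A map of the line with the integers as its only fixed points. -/
def parabolicFun (x : ℝ) : ℝ := x - (1 - Real.cos (2 * Real.pi * x)) / 8

theorem hasDerivAt_parabolicFun (x : ℝ) :
    HasDerivAt parabolicFun (1 - Real.pi / 4 * Real.sin (2 * Real.pi * x)) x := by
  have h1 : HasDerivAt (fun x : ℝ => 2 * Real.pi * x) (2 * Real.pi) x := by
    simpa using (hasDerivAt_id x).const_mul (2 * Real.pi)
  refine HasDerivAt.congr_deriv
    ((hasDerivAt_id x).sub (((h1.cos).const_sub 1).div_const 8)) ?_
  ring

/-- The divisor 8 gives the oscillating term of the derivative the amplitude 2π/8 = π/4, which is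
less than one. -/
theorem deriv_parabolicFun_pos (x : ℝ) : 0 < deriv parabolicFun x := by
  rw [(hasDerivAt_parabolicFun x).deriv]
  have h1 := Real.pi_pos
  have h2 := Real.pi_lt_four
  have h3 := Real.sin_le_one (2 * Real.pi * x)
  nlinarith

theorem contDiff_parabolicFun : ContDiff ℝ ∞ parabolicFun :=
  contDiff_id.sub ((contDiff_const.sub
    (Real.contDiff_cos.comp (contDiff_const.mul contDiff_id))).div_const 8)

theorem parabolicFun_le (x : ℝ) : parabolicFun x ≤ x := by
  have := Real.cos_le_one (2 * Real.pi * x)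
  rw [parabolicFun]
  linarith

theorem le_parabolicFun (x : ℝ) : x - 1 ≤ parabolicFun x := by
  have := Real.neg_one_le_cos (2 * Real.pi * x)
  rw [parabolicFun]
  linarith

theorem parabolicFun_bijective : Function.Bijective parabolicFun := by
  refine ⟨(strictMono_of_deriv_pos deriv_parabolicFun_pos).injective,
    contDiff_parabolicFun.continuous.surjective ?_ ?_⟩
  · exact Filter.tendsto_atTop_mono le_parabolicFun
      (Filter.tendsto_atTop_add_const_right _ (-1) Filter.tendsto_id)
  · exact Filter.tendsto_atBot_mono parabolicFun_le Filter.tendsto_id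

/-- The diffeomorphism of the circle with lift `x ↦ x - (1 - cos 2πx) / 8`, whose iterates contract
the complement of its fixed point `0` to `0`. -/
def parabolic : LiftDiff :=
  ⟨Equiv.ofBijective parabolicFun parabolicFun_bijective, contDiff_parabolicFun,
    deriv_parabolicFun_pos, fun x => by
      change parabolicFun (x + 1) = parabolicFun x + 1
      rw [parabolicFun, parabolicFun, mul_add, mul_one, Real.cos_add_two_pi]
      ring⟩

theorem parabolicFun_eq_self {x : ℝ} (h0 : 0 ≤ x) (h1 : x < 1) (h : parabolicFun x = x) :
    x = 0 := by
  have hc : Real.cos (2 * Real.pi * x) = 1 := by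
    rw [parabolicFun] at h
    linarith
  have hpi := Real.two_pi_pos
  have := (Real.cos_eq_one_iff_of_lt_of_lt (by nlinarith) (by nlinarith)).1 hc
  exact (mul_eq_zero.1 this).resolve_left hpi.ne'

/-- The orbit decreases and is bounded below by the fixed point 0. Its limit is a fixed point in
`[0, 1)`, hence 0. The convergence is only pointwise, as orbits leave the neighbourhood of the fixed
point 1 slowly, but pointwise convergence is all that is used. -/
theorem tendsto_iterate_parabolicFun {x : ℝ} (hx : x ∈ Set.Ico (0 : ℝ) 1) :
    Filter.Tendsto (fun n : ℕ => parabolicFun^[n] x) Filter.atTop (nhds 0) := by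
  have hmono : Monotone parabolicFun := (strictMono_of_deriv_pos deriv_parabolicFun_pos).monotone
  have h00 : parabolicFun 0 = 0 := by simp [parabolicFun]
  have hanti : Antitone fun n : ℕ => parabolicFun^[n] x := antitone_nat_of_succ_le fun n => by
    rw [Function.iterate_succ_apply']
    exact parabolicFun_le _
  have hpos : ∀ n : ℕ, 0 ≤ parabolicFun^[n] x := fun n => by
    have := hmono.iterate n hx.1
    rwa [Function.iterate_fixed h00] at this
  obtain ⟨L, hL⟩ : ∃ L, Filter.Tendsto (fun n : ℕ => parabolicFun^[n] x) Filter.atTop (nhds L) :=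
    ⟨_, tendsto_atTop_ciInf hanti ⟨0, by rintro _ ⟨n, rfl⟩; exact hpos n⟩⟩
  have hfix : parabolicFun L = L :=
    isFixedPt_of_tendsto_iterate hL contDiff_parabolicFun.continuous.continuousAt
  have hL0 : 0 ≤ L := ge_of_tendsto' hL hpos
  have hL1 : L < 1 := (hanti.le_of_tendsto hL 0).trans_lt hx.2
  rwa [parabolicFun_eq_self hL0 hL1 hfix] at hL

theorem pullCircle_parabolic_pow (φ : SmoothCircle) (n : ℕ) (x : ℝ) :
    (pullCircle (parabolic ^ n) φ).1 (x : UnitAddCircle)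
      = φ.1 ((parabolicFun^[n] x : ℝ) : UnitAddCircle) := by
  change φ.1 (((parabolic ^ n).1 x : ℝ) : UnitAddCircle) = _
  rw [SubgroupClass.coe_pow, Equiv.Perm.coe_pow]
  rfl

end LiftDiff

/-! ### Endomorphisms acting on the linear observables -/

/-- The derivative factor in the push-forward of a coefficient is the Jacobian of the substitution
along the fibre and is absorbed by the integral. What remains is composition in the transversal
coordinate, so each function sees only its own diffeomorphism. -/
theorem obsEquiv_pushObs (s : Chirality) (G : LiftDiff × LiftDiff) (v : LinObs) :
    obsEquiv s (pushObs ⟨LiftDiff.toCyl G, G, rfl⟩ v)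
      = (LiftDiff.pullCircle (s.proj G)⁻¹ (obsEquiv s v).1,
        LiftDiff.pullCircle (s.opp.proj G)⁻¹ (obsEquiv s v).2) := by
  induction v using Submodule.Quotient.induction_on with
  | H α =>
    refine (congrArg _ (pushObs_toCyl G α)).trans ?_
    cases s
    · exact Prod.ext (LiftDiff.fiberPlus_pullCoeff G⁻¹ α.2) (LiftDiff.fiberMinus_pullCoeff G⁻¹ α.1)
    · exact Prod.ext (LiftDiff.fiberMinus_pullCoeff G⁻¹ α.1) (LiftDiff.fiberPlus_pullCoeff G⁻¹ α.2)

/-- Endomorphisms that act trivially on `x^±` fix the observables in `𝔏^±`. -/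
theorem pushObs_eq_self {s : Chirality} {f : CylMor} (hf : projMor s f = 1) {v : LinObs}
    (hv : v ∈ chiralObs s) : pushObs f v = v := by
  obtain ⟨_, G, rfl⟩ := f
  -- The lift itself need not be the identity; it may be an integer translation, so the argument
  -- takes place on the circle.
  have h1 : LiftDiff.toCircle (s.proj G)⁻¹ = 1 := by
    rw [map_inv, ← projMor_toCyl, hf]
    exact inv_one
  obtain ⟨c, hc⟩ := mem_chiralObs.1 hv
  apply (obsEquiv s).injective
  rw [obsEquiv_pushObs]
  refine Prod.ext ?_ ?_
  · ext p
    change (obsEquiv s v).1.1 (LiftDiff.toCircle (s.proj G)⁻¹ p) = _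
    rw [h1]
    rfl
  -- A constant function is unchanged by composition with any diffeomorphism.
  · rw [← hc]
    rfl

/-- The diagonal pair `(G, G)` lifts the diffeomorphism with lift `G` for both chiralities at once.
Consequently every object of the comma category receives a morphism from the identity. -/
theorem projMor_surjective (s : Chirality) : Function.Surjective (projMor s) := by
  rintro ⟨_, G, rfl⟩
  refine ⟨⟨LiftDiff.toCyl (G, G), (G, G), rfl⟩, Subtype.ext ((projMor_toCyl s (G, G)).trans ?_)⟩
  cases s <;> rfl

/-- The projection of the linear observables onto `𝔏^±` which evaluates functions of the opposite
light-cone coordinate at the point `0`. -/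
def collapse (s : Chirality) : LinObs →ₗ[ℝ] chiralObs s :=
  (chiralObsEquiv s).toLinearMap ∘ₗ
    LinearMap.prodMap LinearMap.id (SmoothCircle.evalAt 0) ∘ₗ (obsEquiv s).toLinearMap

theorem obsEquiv_collapse (s : Chirality) (v : LinObs) : obsEquiv s (collapse s v).1
    = ((obsEquiv s v).1, SmoothCircle.const ((obsEquiv s v).2.1 0)) :=
  obsEquiv_chiralObsEquiv s _

/-- Every diffeomorphism acts on the functions of the opposite light-cone coordinate only, through
an endomorphism of the cylinder. -/
theorem exists_pushObs_eq (s : Chirality) (H : LiftDiff) : ∃ f : CylMor, projMor s f = 1 ∧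
    ∀ v, obsEquiv s (pushObs f v) = ((obsEquiv s v).1, LiftDiff.pullCircle H (obsEquiv s v).2) := by
  -- Push-forward composes with the inverse, so `H⁻¹` is needed to obtain composition with `H`.
  obtain ⟨G, h1, h2⟩ : ∃ G : LiftDiff × LiftDiff, s.proj G = 1 ∧ s.opp.proj G = H⁻¹ := by
    cases s
    · exact ⟨(1, H⁻¹), rfl, rfl⟩
    · exact ⟨(H⁻¹, 1), rfl, rfl⟩
  refine ⟨⟨LiftDiff.toCyl G, G, rfl⟩, Subtype.ext ?_, fun v => ?_⟩
  · rw [projMor_toCyl, h1, map_one]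
    rfl
  · rw [obsEquiv_pushObs, h1, h2, inv_inv, inv_one]
    refine Prod.ext ?_ rfl
    ext p
    change (obsEquiv s v).1.1 (LiftDiff.toCircle 1 p) = _
    rw [map_one]
    rfl

/-! ### Invariant elements -/

/-- The linear functionals on the linear observables spanned by point evaluations of the fiber
integrals. -/
def pointFunctionals (s : Chirality) : Submodule ℝ (Module.Dual ℝ LinObs) :=
  Submodule.span ℝ
    (Set.range (fun p => SmoothCircle.evalAt p ∘ₗ LinearMap.fst ℝ _ _ ∘ₗ (obsEquiv s).toLinearMap) ∪
      Set.range fun p => SmoothCircle.evalAt p ∘ₗ LinearMap.snd ℝ _ _ ∘ₗ (obsEquiv s).toLinearMap)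

theorem eq_zero_of_pointFunctionals {s : Chirality} {v : LinObs}
    (h : ∀ ℓ ∈ pointFunctionals s, ℓ v = 0) : v = 0 := by
  refine (obsEquiv s).map_eq_zero_iff.1 (Prod.ext ?_ ?_)
  · ext p
    exact h _ (Submodule.subset_span (Or.inl ⟨p, rfl⟩))
  · ext p
    exact h _ (Submodule.subset_span (Or.inr ⟨p, rfl⟩))

/-- Evaluating a function of `x^∓` at p after the n-th push-forward is evaluation at the n-th
iterate of p, which tends to 0, and the function is continuous. Functions of `x^±` do not move. -/
theorem tendsto_pointFunctionals {s : Chirality} {f : ℕ → CylMor}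
    (hf : ∀ n v, obsEquiv s (pushObs (f n) v)
      = ((obsEquiv s v).1, LiftDiff.pullCircle (LiftDiff.parabolic ^ n) (obsEquiv s v).2))
    {ℓ : Module.Dual ℝ LinObs} (hℓ : ℓ ∈ pointFunctionals s) (v : LinObs) :
    Filter.Tendsto (fun n => ℓ (pushObs (f n) v)) Filter.atTop (nhds (ℓ (collapse s v).1)) := by
  induction hℓ using Submodule.span_induction with
  | zero => exact tendsto_const_nhds
  | add ℓ ℓ' _ _ h h' => exact h.add h'
  | smul c ℓ _ h => exact h.const_mul c
  | mem ℓ hℓ =>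
    rcases hℓ with ⟨p, rfl⟩ | ⟨p, rfl⟩
    · have h : ∀ w, (SmoothCircle.evalAt p ∘ₗ LinearMap.fst ℝ _ _ ∘ₗ (obsEquiv s).toLinearMap) w
          = (obsEquiv s w).1.1 p := fun _ => rfl
      simp only [h, hf, obsEquiv_collapse]
      exact tendsto_const_nhds
    · have h : ∀ w, (SmoothCircle.evalAt p ∘ₗ LinearMap.snd ℝ _ _ ∘ₗ (obsEquiv s).toLinearMap) w
          = (obsEquiv s w).2.1 p := fun _ => rfl
      -- The half-open interval matters: the orbit of a representative in `[0, 1)` tends to 0,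
      -- whereas the representative 1 would stay fixed.
      obtain ⟨x, hx, rfl⟩ : ∃ x ∈ Set.Ico (0 : ℝ) 1, (x : UnitAddCircle) = p := by
        have := AddCircle.coe_image_Ico_eq (1 : ℝ) 0
        rw [zero_add] at this
        exact (Set.ext_iff.1 this p).2 trivial
      simp only [h, hf, obsEquiv_collapse, LiftDiff.pullCircle_parabolic_pow]
      exact ((obsEquiv s v).2.smooth.continuous.tendsto 0).comp
        (LiftDiff.tendsto_iterate_parabolicFun hx)

/-- The elements of `𝔄(𝕄/ℤ)` that are invariant under the endomorphisms acting trivially on `x^±`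
form the subalgebra `CCR(𝔏^±, τ)`. -/
theorem mem_range_chiralIncl (s : Chirality) (a : CylAlg) : a ∈ (chiralIncl s).range ↔
    ∀ f : CylMor, projMor s f = 1 → cylAction f a = a := by
  constructor
  · rintro ⟨b, rfl⟩ f hf
    have h : pushObs f ∘ₗ (chiralObs s).subtype = (chiralObs s).subtype :=
      LinearMap.ext fun v => pushObs_eq_self hf v.2
    refine (SymC.map_map (pushObs f) (chiralObs s).subtype b).trans ?_
    rw [h]
    rfl
  · intro h
    choose f hf1 hf2 using fun n : ℕ => exists_pushObs_eq s (LiftDiff.parabolic ^ n)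
    let b : SymC LinObs := a
    have hb : ∀ n, SymC.map (pushObs (f n)) b = b := fun n => h (f n) (hf1 n)
    -- For a point functional ℓ the value of `b` at ℓ composed with the n-th push-forward is
    -- constant in n by invariance, and it converges to the value at ℓ composed with `collapse`.
    -- Uniqueness of limits gives equality for every such ℓ, and these functionals separate.
    have key : SymC.map ((chiralObs s).subtype ∘ₗ collapse s) b = b := by
      refine SymC.eq_of_eval_eq (D := pointFunctionals s)
        (fun v hv => eq_zero_of_pointFunctionals hv) fun ℓ hℓ => ?_
      rw [SymC.eval_map]
      refine tendsto_nhds_unique (SymC.tendsto_eval (F := Filter.atTop)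
        (ℓ := fun n => ℓ ∘ₗ pushObs (f n)) (tendsto_pointFunctionals hf2 hℓ) b) ?_
      refine tendsto_const_nhds.congr fun n => ?_
      rw [← SymC.eval_map, hb]
    exact ⟨SymC.map (collapse s) b, (SymC.map_map _ _ b).trans key⟩

/-! ### The chiral component -/

/-- Compatibility along an endomorphism over `h` computes the member of a family at `h` from its
member at the identity. -/
theorem chiralComponent.toCylAlg_injective (s : Chirality) :
    Function.Injective (chiralComponent.toCylAlg s) := by
  intro a b hab
  refine Subtype.ext (funext fun h => ?_)
  obtain ⟨f, rfl⟩ := projMor_surjective s h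
  have ha := a.2 f 1
  have hb := b.2 f 1
  rw [mul_one] at ha hb
  rw [← ha, ← hb]
  exact congrArg _ hab

theorem chiralComponent.mem_range_toCylAlg (s : Chirality) (a : CylAlg) :
    a ∈ (chiralComponent.toCylAlg s).range ↔
      ∀ f : CylMor, projMor s f = 1 → cylAction f a = a := by
  constructor
  · rintro ⟨b, rfl⟩ f hf
    refine (b.2 f 1).trans ?_
    rw [hf, mul_one]
    rfl
  · intro h
    -- Two endomorphisms over the same circle diffeomorphism differ by an element of the kernel,
    -- which fixes `a`.
    have heq : ∀ f g : CylMor, projMor s f = projMor s g → cylAction f a = cylAction g a := by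
      intro f g hfg
      have h1 := h (g⁻¹ * f) (by rw [map_mul, map_inv, hfg, inv_mul_cancel])
      have h2 : f = g * (g⁻¹ * f) := by group
      rw [h2, map_mul]
      exact congrArg (cylAction g) h1
    -- The section `r` need not be multiplicative, since `heq` removes the dependence on choices.
    -- Likewise `r 1` need not be the identity; it lies in the kernel, so the member of the family
    -- at the identity is still `a`.
    choose r hr using projMor_surjective s
    refine ⟨⟨fun k => cylAction (r k) a, fun f k => ?_⟩, h _ (hr 1)⟩
    have hk := heq (r (projMor s f * k)) (f * r k) (by rw [hr, map_mul, hr])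
    rw [map_mul] at hk
    exact hk.symm

end

/-! ### The chiral component as a CCR algebra and as a tensor product -/

theorem proposition6p2 (s : Chirality) :
    -- the canonical map `(π_±)_* 𝔄 (𝕋) → 𝔄(𝕄/ℤ)` is injective, with image the elements that are
    -- invariant under the endomorphisms acting only on the opposite chirality
    Function.Injective (chiralComponent.toCylAlg s) ∧
    (∀ a : CylAlg, a ∈ (chiralComponent.toCylAlg s).range ↔
      ∀ f : CylMor, projMor s f = 1 → cylAction f a = a) ∧
    -- `𝔏^±` is the direct sum of the summand of opposite duality and a line of cohomology classes
    Disjoint (dualObs s.opp) (dualCohom s) ∧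
    Module.finrank ℝ (dualCohom s) = 1 ∧
    -- `(π_±)_* 𝔄 (𝕋) = CCR(𝔏^±, τ)` as `*`-subalgebras of `𝔄(𝕄/ℤ)`
    Function.Injective (chiralIncl s) ∧
    (chiralComponent.toCylAlg s).range = (chiralIncl s).range ∧
    -- `(π_±)_* 𝔄 (𝕋)` is the tensor product of the chiral currents on `𝕋` and `Sym ℝ`
    Nonempty (chiralComponent s ≃⋆ₐ[ℂ] (CCR SmoothCircle.poisson ⊗[ℂ] SymC ℝ)) := by
  have hrange : (chiralComponent.toCylAlg s).range = (chiralIncl s).range := by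
    ext a
    rw [chiralComponent.mem_range_toCylAlg, mem_range_chiralIncl]
  have hinj : Function.Injective (chiralIncl s) :=
    CCR.map_injective _ (chiralObs s).injective_subtype
  refine ⟨chiralComponent.toCylAlg_injective s, chiralComponent.mem_range_toCylAlg s,
    disjoint_dualObs_dualCohom s, finrank_dualCohom s, hinj, hrange, ⟨?_⟩⟩
  -- Both algebras embed in 𝔄(𝕄/ℤ) with the same image. Rewriting the image composes the two
  -- embeddings to an isomorphism with CCR(𝔏^±, τ), from which the null line of constants is then
  -- split off.
  have e1 := StarAlgEquiv.ofInjective _ (chiralComponent.toCylAlg_injective s)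
  rw [hrange] at e1
  exact e1.trans ((StarAlgEquiv.ofInjective _ hinj).symm.trans
    ((CCR.congr (chiralObsEquiv s) (tauCyl_chiralObsEquiv s)).symm.trans
      (CCR.prodZeroEquiv SmoothCircle.poisson).symm))
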